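/- **Conventions.** All spaces are real. For a function $f$ on an open subset $V$ of a normed space, with values in a topological vector space, the directional derivative is $\partial_x f(u)=\lim_{t\to 0}\frac{f(u+tx)-f(u)}{t}$, and recursively $\partial^m_{x_1\dots x_m}f:=\partial_{x_m}\bigl(\partial^{m-1}_{x_1\dots x_{m-1}}f\bigr)$. Let $X_0$ be a normed space continuously embedded in a normed space $Z$, let $V\subset Z$ be open and let $E$ be a normed space. $L_s^{(k)}(X_0^k,E)$ is the space of $k$-linear maps $X_0^k\to E$ that are continuous in each variable separately, with the topology of pointwise convergence; $L_s^{(k+1)}(X_0^{k+1},E)$ is identified with the space of continuous linear maps from $X_0$ to $L_s^{(k)}(X_0^k,E)$ with the topology of pointwise convergence. A function $f$ on $V$ is Gâteaux differentiable with respect to $X_0$ if, for each $u\in V$, $\partial_xf(u)$ exists for all $x\in X_0$ and $x\mapsto\partial_xf(u)$, denoted $\partial_{X_0}f(u)$, is linear and continuous on $X_0$. $\mathcal G^m(V,E;X_0)$ is the set of continuous $f:V\to E$ such that $\partial^0_{X_0}f:=f$ and, successively for $k=0,\dots,m-1$, $\partial_{X_0}^k f:V\to L_s^{(k)}(X_0^k,E)$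 is Gâteaux differentiable with respect to $X_0$ with continuous differential $\partial^{k+1}_{X_0}f:V\to L_s^{(k+1)}(X_0^{k+1},E)$. $\mathcal G^m(V,E):=\mathcal G^m(V,E;Z)$. **Assumption.** 1. $n\ge 1$ and $\alpha\in[0,1)$; $X$ is a Banach space and $U\subset X$ is open. 2. $Y_1\supset Y_2\supset\dots\supset Y_n$ are Banach spaces with norms $|\cdot|_1,\dots,|\cdot|_n$, and for $1\le j\le k\le n$ the inclusion $Y_k\to Y_j$ is continuous. 3. $h_1:U\times Y_1\to Y_1$ satisfies $h_1(U\times Y_k)\subset Y_k$ for $k=2,\dots,n$; $h_k:U\times Y_k\to Y_k$ denotes the induced map. 4. For $k=1,\dots,n$, $h_k$ is continuous and $|h_k(u,y)-h_k(u,y')|_k\le\alpha|y-y'|_k$ for all $u\in U$, $y,y'\in Y_k$. 5. For $k=1,\dots,n$, $h_k\in\mathcal G^n(U\times Y_k,Y_k;X\times\{0\})$. 6. For $k=1,\dots,n-1$, $h_k\in\mathcal G^n(U\times Y_k,Y_k;X\times Y_{k+1})$. 7. For $k=1,\dots,n$, $j=0,1,\dots,n-1$, all $u\in U$, $z_1,\dots,z_j\in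 X$, $y,z_{j+1}\in Y_k$ and all permutations $\sigma$ of $\{1,\dots,j+1\}$, the directional derivative $\partial^{j+1}_{z_{\sigma(1)}\dots z_{\sigma(j+1)}}h_k(u,y)$ exists, and it is jointly continuous, as a map $U\times Y_k\times X^j\times Y_k\to Y_k$, in $(u,y,z_1,\dots,z_j,z_{j+1})$. Here, as below, elements of $X$ and of $Y_k$ are regarded as increments in $X\times\{0\}$ and in $\{0\}\times Y_k$. **Theorem 2.12.** Let the Assumption hold and let $\varphi:U\to Y_1$ be the fixed-point map of $h_1$, i.e. $h_1(u,\varphi(u))=\varphi(u)$ for $u\in U$. Then, for $j=1,\dots,n$, $\varphi$ is $Y_{n-j+1}$-valued and $\varphi\in\mathcal G^j(U,Y_{n-j+1})$. Moreover, for all $u\in U$, the Gâteaux differential $\partial_{Y_1}h_1(u,\varphi(u))$ of $h_1$ along $\{0\}\times Y_1$ exists in $L(Y_1)$, $I-\partial_{Y_1}h_1(u,\varphi(u))$ is invertible in $L(Y_1)$, and for $j=1,\dots,n$ and all $x_1,\dots,x_j\in X$ the following directional derivatives exist and satisfy $$\partial^j_{x_1\dots x_j}\varphi(u)=(I-\partial_{Y_1}h_1(u,\varphi(u)))^{-1}\partial^j_{x_1\dots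 x_j}h_1(u,\varphi(u))+\sum_{\emptyset\ne\mathbf x\subset\{x_1,\dots,x_j\}}\ \sum_{i=\max\{1,2-j+|\mathbf x|\}}^{|\mathbf x|}\ \sum_{\mathbf p=\{\mathbf p_1,\dots,\mathbf p_i\}\in P^i(\mathbf x)}(I-\partial_{Y_1}h_1(u,\varphi(u)))^{-1}\,\partial^j[\mathbf x^c,\mathbf p]h_1(u,\varphi(u)).\qquad(2.21)$$ Here subsets of $\{x_1,\dots,x_j\}$ are understood as subsets of the index set $\{1,\dots,j\}$, $P^i(\mathbf x)$ is the set of partitions of $\mathbf x$ into $i$ non-empty parts, $\mathbf x^c:=\{x_1,\dots,x_j\}\setminus\mathbf x$, for $\mathbf q=\{y_1,\dots,y_m\}$ one writes $\partial^{m}_{\mathbf q}:=\partial^m_{y_1\dots y_m}$, and $$\partial^j[\mathbf x^c,\mathbf p]h_1(u,\varphi(u)):=\partial_{\mathbf x^c}^{\,j-|\mathbf x|}\,\partial_{\partial^{|\mathbf p_1|}_{\mathbf p_1}\varphi(u)}\cdots\partial_{\partial^{|\mathbf p_i|}_{\mathbf p_i}\varphi(u)}h_1\,(u,\varphi(u)),$$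 the increments $\partial^{|\mathbf p_l|}_{\mathbf p_l}\varphi(u)\in Y_1$ being held fixed in the differentiation of $h_1$. The order of differentiation is immaterial in all these expressions. -/

import Mathlib

open Set Filter Topology

noncomputable section

/-- `f'` is the directional derivative of `f` at `u` for the increment `x`, i.e. the limit of
`(f (u + t x) - f u) / t` as `t → 0`, `t ≠ 0`, for values in an arbitrary topological vector space
(for normed spaces this is Mathlib's `HasLineDerivAt ℝ f f' u x`). -/
def HasDirDerivAt {E F : Type*} [AddCommGroup E] [Module ℝ E] [AddCommGroup F] [Module ℝ F]
    [TopologicalSpace F] (f : E → F) (f' : F) (u x : E) : Prop :=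
  Tendsto (fun t : ℝ => t⁻¹ • (f (u + t • x) - f u)) (𝓝[≠] 0) (𝓝 f')

/-- The iterated directional derivative `∂^m_{x₁ … x_m} f`, where
`∂^m_{x₁ … x_m} f := ∂_{x_m} (∂^{m-1}_{x₁ … x_{m-1}} f)`; the list is `[x₁, …, x_m]`, so that the
first entry is differentiated first. Its existence is expressed by `DirDerivExistsOn`. -/
def iterDirDeriv {E F : Type*} [AddCommGroup E] [Module ℝ E] [NormedAddCommGroup F]
    [NormedSpace ℝ F] : (E → F) → List E → E → F
  | f, [] => f
  | f, x :: xs => iterDirDeriv (fun u => lineDeriv ℝ f u x) xs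

/-- `∂^m_{x₁ … x_m} f (u)` exists (as an iterated limit) for every `u ∈ V`. -/
def DirDerivExistsOn {E F : Type*} [AddCommGroup E] [Module ℝ E] [NormedAddCommGroup F]
    [NormedSpace ℝ F] (V : Set E) : (E → F) → List E → Prop
  | _, [] => True
  | f, x :: xs => (∀ u ∈ V, LineDifferentiableAt ℝ f u x) ∧
      DirDerivExistsOn V (fun u => lineDeriv ℝ f u x) xs

section SeparatelyContinuous

variable (n : ℕ) (E F : Type*) [NormedAddCommGroup E] [NormedSpace ℝ E]
  [NormedAddCommGroup F] [NormedSpace ℝ F]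

/-- The space `L_s^{(n)}(Eⁿ, F)` of `n`-linear maps `Eⁿ → F` that are continuous with respect to
each variable separately. -/
def SepContMultilinear : Submodule ℝ (MultilinearMap ℝ (fun _ : Fin n => E) F) where
  carrier := {Λ | ∀ (m : Fin n → E) (i : Fin n),
    Continuous fun x : E => Λ (Function.update m i x)}
  add_mem' := fun ha hb m i => (ha m i).add (hb m i)
  zero_mem' := fun _ _ => continuous_const
  smul_mem' := fun c _ ha m i => (ha m i).const_smul c

/-- `L_s^{(n)}(Eⁿ, F)` carries the topology of pointwise convergence, the coarsest one making all
the evaluations `Λ ↦ Λ(x₁, …, x_n)` continuous. -/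
instance : TopologicalSpace (SepContMultilinear n E F) :=
  TopologicalSpace.induced (fun Λ m => Λ.1 m) inferInstance

variable {n E F}

/-- `Λ(·, …, ·, x)`, the last argument being frozen. -/
def sepContEvalLast (Λ : SepContMultilinear (n + 1) E F) (x : E) :
    SepContMultilinear n E F :=
  ⟨{ toFun := fun m => Λ.1 (Fin.snoc m x)
     map_update_add' := by
      intro inst m i a b
      obtain rfl : inst = instDecidableEqFin n := Subsingleton.elim _ _
      simp only [Fin.snoc_update, MultilinearMap.map_update_add]
     map_update_smul' := by
      intro inst m i c a
      obtain rfl : inst = instDecidableEqFin n := Subsingleton.elim _ _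
      simp only [Fin.snoc_update, MultilinearMap.map_update_smul] },
   by
    intro m i
    simpa only [MultilinearMap.coe_mk, Fin.snoc_update] using Λ.2 (Fin.snoc m x) i.castSucc⟩

/-- The canonical identification of `L_s^{(n+1)}(E^{n+1}, F)` with `L_s(E, L_s^{(n)}(Eⁿ, F))`:
`Λ ↦ (x ↦ ((x₁, …, x_n) ↦ Λ(x₁, …, x_n, x)))`. -/
def sepContCurryLast (Λ : SepContMultilinear (n + 1) E F) :
    E →L[ℝ] SepContMultilinear n E F where
  toFun := sepContEvalLast Λ
  map_add' := by
    intro x y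
    refine Subtype.ext (MultilinearMap.ext fun m => ?_)
    have := Λ.1.map_update_add (Fin.snoc m x) (Fin.last n) x y
    simp only [Fin.update_snoc_last] at this
    exact this
  map_smul' := by
    intro c x
    refine Subtype.ext (MultilinearMap.ext fun m => ?_)
    have := Λ.1.map_update_smul (Fin.snoc m x) (Fin.last n) c x
    simp only [Fin.update_snoc_last] at this
    exact this
  cont := by
    refine continuous_induced_rng.2 (continuous_pi fun m => ?_)
    have := Λ.2 (Fin.snoc m 0) (Fin.last n)
    simp only [Fin.update_snoc_last] at this
    exact this

end SeparatelyContinuous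

/-- `A ∈ L(X₀, Y)` is the Gâteaux differential `∂_{X₀} f(u)` of `f` at `u` with respect to `X₀`,
where `X₀` is embedded into `X` by `ι`. -/
def IsGateauxDiffAt {X₀ X Y : Type*} [NormedAddCommGroup X₀] [NormedSpace ℝ X₀]
    [NormedAddCommGroup X] [NormedSpace ℝ X] [AddCommGroup Y] [Module ℝ Y] [TopologicalSpace Y]
    (ι : X₀ →L[ℝ] X) (f : X → Y) (u : X) (A : X₀ →L[ℝ] Y) : Prop :=
  ∀ x : X₀, HasDirDerivAt f (A x) u (ι x)

/-- `f ∈ 𝒢ⁿ(V, Y; X₀)`, where `X₀` is embedded into `X` by `ι` and `V ⊆ X` is open: `f` is continuous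
on `V` and strongly continuously Gâteaux differentiable up to order `n` with respect to `X₀`.
Here `D k` is `∂^k_{X₀} f : V → L_s^{(k)}(X₀^k, Y)`, and `D (k + 1)` is the Gâteaux differential of
`D k` with respect to `X₀`, continuous for the topology of `L_s^{(k+1)}(X₀^{k+1}, Y)`. Values of `f`
outside `V` are irrelevant. -/
def GSpace {X₀ X Y : Type*} [NormedAddCommGroup X₀] [NormedSpace ℝ X₀]
    [NormedAddCommGroup X] [NormedSpace ℝ X] [NormedAddCommGroup Y] [NormedSpace ℝ Y]
    (n : ℕ) (ι : X₀ →L[ℝ] X) (V : Set X) (f : X → Y) : Prop :=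
  ContinuousOn f V ∧
  ∃ D : (k : ℕ) → X → SepContMultilinear k X₀ Y,
    (∀ u ∈ V, ∀ m : Fin 0 → X₀, (D 0 u).1 m = f u) ∧
    ∀ k < n,
      (∀ u ∈ V, IsGateauxDiffAt ι (D k) u (sepContCurryLast (D (k + 1) u))) ∧
      ContinuousOn (D (k + 1)) V

/-- The standing assumption on a decreasing chain `Y₁ ⊇ Y₂ ⊇ … ⊇ Y_n` of Banach spaces and on the
maps `h_k : U × Y_k → Y_k`. The inclusion of `Y_k` into `Y_j` is `emb k j`. Only the indices
`1, …, n` matter: `Y k`, `h k` and `emb k j` are unconstrained for all other indices, and so are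
the values of `h k` outside `U × Y_k`. -/
structure ChainContraction {X : Type*} [NormedAddCommGroup X] [NormedSpace ℝ X]
    {Y : ℕ → Type*} [∀ k, NormedAddCommGroup (Y k)] [∀ k, NormedSpace ℝ (Y k)]
    (n : ℕ) (α : ℝ) (U : Set X) (emb : ∀ k j, Y k →L[ℝ] Y j) (h : ∀ k, X × Y k → Y k) : Prop where
  one_le : 1 ≤ n
  alpha_nonneg : 0 ≤ α
  alpha_lt_one : α < 1
  isOpen : IsOpen U
  /-- the embeddings are injective and compatible, as the inclusions of a decreasing chain -/
  emb_injective : ∀ k j, 1 ≤ j → j ≤ k → k ≤ n → Function.Injective (emb k j)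
  emb_self : ∀ k, 1 ≤ k → k ≤ n → ∀ y, emb k k y = y
  emb_comp : ∀ k j l, 1 ≤ l → l ≤ j → j ≤ k → k ≤ n → ∀ y, emb j l (emb k j y) = emb k l y
  /-- `h₁` maps `U × Y_k` into `Y_k`, and `h_k` is the induced map -/
  induced : ∀ k, 1 ≤ k → k ≤ n → ∀ u ∈ U, ∀ y : Y k, h 1 (u, emb k 1 y) = emb k 1 (h k (u, y))
  continuousOn : ∀ k, 1 ≤ k → k ≤ n → ContinuousOn (h k) (U ×ˢ univ)
  contraction : ∀ k, 1 ≤ k → k ≤ n → ∀ u ∈ U, ∀ y y' : Y k,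
    ‖h k (u, y) - h k (u, y')‖ ≤ α * ‖y - y'‖
  /-- `h_k ∈ 𝒢ⁿ(U × Y_k, Y_k; X × {0})` -/
  gateaux_param : ∀ k, 1 ≤ k → k ≤ n →
    GSpace n (ContinuousLinearMap.inl ℝ X (Y k)) (U ×ˢ univ) (h k)
  /-- `h_k ∈ 𝒢ⁿ(U × Y_k, Y_k; X × Y_{k+1})` -/
  gateaux_subspace : ∀ k, 1 ≤ k → k + 1 ≤ n →
    GSpace n ((ContinuousLinearMap.id ℝ X).prodMap (emb (k + 1) k)) (U ×ˢ univ) (h k)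
  /-- existence and joint continuity of the derivatives of `h_k` in `j` directions of `X` and one
  direction of `Y_k`, in any order; `j = 0` is the derivative along `Y_k` alone -/
  mixed_exists : ∀ k, 1 ≤ k → k ≤ n → ∀ j < n, ∀ σ : Equiv.Perm (Fin (j + 1)),
    ∀ (z : Fin j → X) (w : Y k),
      DirDerivExistsOn (U ×ˢ univ) (h k)
        (List.ofFn fun a => (Fin.snoc (fun b => (z b, 0)) (0, w) : Fin (j + 1) → X × Y k) (σ a))
  mixed_continuous : ∀ k, 1 ≤ k → k ≤ n → ∀ j < n, ∀ σ : Equiv.Perm (Fin (j + 1)),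
    ContinuousOn
      (fun q : (X × Y k) × (Fin j → X) × Y k =>
        iterDirDeriv (h k)
          (List.ofFn fun a =>
            (Fin.snoc (fun b => (q.2.1 b, 0)) (0, q.2.2) : Fin (j + 1) → X × Y k) (σ a)) q.1)
      ((U ×ˢ univ) ×ˢ univ)

/-- The increments of the derivative `∂^j[𝐱ᶜ, 𝐩]` at `u`, for `𝐱 = {x_a : a ∈ s}` and a partition `𝐩` of
`s`: the vectors `(0, ∂^{|p|}_{p} φ(u))` for the blocks `p` of `𝐩`, followed by `(x_a, 0)` for
`a ∉ s`. -/
def blockIncrements {X Y : Type*} [NormedAddCommGroup X] [NormedSpace ℝ X]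
    [NormedAddCommGroup Y] [NormedSpace ℝ Y] (φ : X → Y) (u : X) {j : ℕ} (x : Fin j → X)
    (s : Finset (Fin j)) (P : Finpartition s) : List (X × Y) :=
  (P.parts.toList.map fun p => ((0 : X), iterDirDeriv φ ((p.sort (· ≤ ·)).map x) u)) ++
    ((sᶜ.sort (· ≤ ·)).map fun a => (x a, (0 : Y)))

end

/-!
Write `A = ∂_Y h (u, φ u)`, an operator of norm at most `α < 1`. Since `h (u, ·)` is an
`α`-contraction, a fixed-point map can be differentiated without any a priori regularity: if
`z = A z + r` is the linearized equation, then the error `φ (u + t x) - φ u - t z` is at most `α` times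
itself plus `o(t)`, so it is `o(t)` (`tendsto_inv_smul_of_contraction`). This gives
`φ ∈ 𝒢¹(U, Y_k)` for every `k` (`contGateaux_one_fixedPoint`).

A further order costs one space of the chain. If `φ` is `j` times differentiable with values in
`Z = Y_{k+1}`, then a derivative `w = ∂_s φ` of order at most `j` solves `w = A w + R` in `Y = Y_k`,
where `R` is a sum of derivatives of `h` whose increments are derivatives of `φ` of lower order. All
these increments, and `w` itself, lie in `Z`, so `R` and `u ↦ A(u) w` (for fixed `w`) can be
differentiated because `h ∈ 𝒢ⁿ(U × Y, Y; X × Z)`; the contraction argument, applied to the linear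
equation, then yields the derivative of `w` in `Y` and its equation (`setDeriv_fixedPoint`,
`contGateaux_succ_fixedPoint`). The terms of `R` are indexed by the families of disjoint non-empty
subsets of `s` other than `{s}` (`partialPartitions`); differentiation in a new direction `x a` either
leaves `a` outside the blocks, or makes `{a}` a block, or adds `a` to a block, which is the recursion
`sum_partialPartitions_insert`. Solving for `w` by a Neumann series gives the formula.

Three facts make the class `𝒢ⁿ` manageable. Existence and continuity of the iterated directional
derivatives for fixed increments already imply symmetry (Schwarz, `lineDeriv_lineDeriv_comm`),
additivity, and, by Baire's theorem, continuity in each increment (`continuous_of_hasLineDerivAt`); so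
`GSpace` is equivalent to the simpler `ContGateaux`. By the Banach–Steinhaus theorem the derivatives
are jointly continuous in the base point and the increments (`ContGateaux.tendsto_multiDeriv`). This
in turn yields the chain rule `ContGateaux.tendsto_slope_multiDeriv`.
-/

/-! ### Iterated directional derivatives -/

section IteratedDerivatives

variable {E F G : Type*} [NormedAddCommGroup E] [NormedSpace ℝ E]
  [NormedAddCommGroup F] [NormedSpace ℝ F] [NormedAddCommGroup G] [NormedSpace ℝ G]

theorem iterDirDeriv_append (f : E → F) (l₁ l₂ : List E) :
    iterDirDeriv f (l₁ ++ l₂) = iterDirDeriv (iterDirDeriv f l₁) l₂ := by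
  induction l₁ generalizing f with
  | nil => rfl
  | cons x l ih => exact ih _

theorem dirDerivExistsOn_append {V : Set E} (f : E → F) (l₁ l₂ : List E) :
    DirDerivExistsOn V f (l₁ ++ l₂) ↔
      DirDerivExistsOn V f l₁ ∧ DirDerivExistsOn V (iterDirDeriv f l₁) l₂ := by
  induction l₁ generalizing f with
  | nil => simp [DirDerivExistsOn, iterDirDeriv]
  | cons x l ih => simp only [List.cons_append, DirDerivExistsOn, ih, iterDirDeriv, and_assoc]

variable {V : Set E}

theorem eqOn_lineDeriv (hV : IsOpen V) {f g : E → F} (h : EqOn f g V) (x : E) :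
    EqOn (fun u => lineDeriv ℝ f u x) (fun u => lineDeriv ℝ g u x) V := fun _ hu =>
  (h.eventuallyEq_of_mem (hV.mem_nhds hu)).lineDeriv_eq

theorem eqOn_iterDirDeriv (hV : IsOpen V) {f g : E → F} (h : EqOn f g V) (l : List E) :
    EqOn (iterDirDeriv f l) (iterDirDeriv g l) V := by
  induction l generalizing f g with
  | nil => exact h
  | cons x l ih => exact ih (eqOn_lineDeriv hV h x)

theorem DirDerivExistsOn.congr (hV : IsOpen V) {f g : E → F} {l : List E}
    (hf : DirDerivExistsOn V f l) (h : EqOn f g V) : DirDerivExistsOn V g l := by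
  induction l generalizing f g with
  | nil => trivial
  | cons x l ih =>
    exact ⟨fun u hu => ((h.eventuallyEq_of_mem (hV.mem_nhds hu)).lineDifferentiableAt_iff).1
      (hf.1 u hu), ih hf.2 (eqOn_lineDeriv hV h x)⟩

theorem DirDerivExistsOn.clm_comp (hV : IsOpen V) (A : F →L[ℝ] G) {f : E → F} {l : List E}
    (hf : DirDerivExistsOn V f l) :
    DirDerivExistsOn V (fun u => A (f u)) l ∧
      EqOn (iterDirDeriv (fun u => A (f u)) l) (fun u => A (iterDirDeriv f l u)) V := by
  induction l generalizing f with
  | nil => exact ⟨trivial, fun _ _ => rfl⟩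
  | cons x l ih =>
    have key : ∀ u ∈ V, HasLineDerivAt ℝ (fun u => A (f u)) (A (lineDeriv ℝ f u x)) u x :=
      fun u hu => A.hasFDerivAt.comp_hasDerivAt (0 : ℝ) (hf.1 u hu).hasLineDerivAt
    have heq : EqOn (fun u => A (lineDeriv ℝ f u x))
        (fun u => lineDeriv ℝ (fun u => A (f u)) u x) V := fun u hu => (key u hu).lineDeriv.symm
    obtain ⟨h1, h2⟩ := ih hf.2
    exact ⟨⟨fun u hu => (key u hu).lineDifferentiableAt, h1.congr hV heq⟩,
      (eqOn_iterDirDeriv hV heq l).symm.trans h2⟩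

/-- Mean value inequality along a segment. -/
theorem norm_sub_sub_smul_le_of_lineDeriv {f : E → F} {v y : E} {c : F} {t ε : ℝ}
    (hd : ∀ θ ∈ Icc (0 : ℝ) 1, LineDifferentiableAt ℝ f (v + (θ * t) • y) y)
    (hb : ∀ θ ∈ Icc (0 : ℝ) 1, ‖lineDeriv ℝ f (v + (θ * t) • y) y - c‖ ≤ ε) :
    ‖f (v + t • y) - f v - t • c‖ ≤ |t| * ε := by
  have key : ∀ θ ∈ Icc (0 : ℝ) 1, HasDerivWithinAt (fun θ : ℝ => f (v + (θ * t) • y) - (θ * t) • c)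
      (t • (lineDeriv ℝ f (v + (θ * t) • y) y - c)) (Icc 0 1) θ := by
    intro θ hθ
    have h1 : HasDerivAt (fun r : ℝ => f (v + (θ * t) • y + r • y))
        (lineDeriv ℝ f (v + (θ * t) • y) y) 0 := (hd θ hθ).hasLineDerivAt
    have h2 : HasDerivAt (fun r : ℝ => (r - θ) * t) t θ := by
      simpa using ((hasDerivAt_id θ).sub_const θ).mul_const t
    have h3 : HasDerivAt (fun r : ℝ => (r * t) • c) (t • c) θ := by
      simpa using ((hasDerivAt_id θ).mul_const t).smul_const c
    have h4 := HasDerivAt.scomp_of_eq θ h1 h2 (by simp)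
    rw [smul_sub]
    refine (HasDerivAt.sub ?_ h3).hasDerivWithinAt
    refine h4.congr_of_eventuallyEq (Eventually.of_forall fun r => ?_)
    simp only [Function.comp]
    congr 1
    module
  have := norm_image_sub_le_of_norm_deriv_le_segment_01' key (C := |t| * ε) (fun θ hθ => by
    rw [norm_smul, Real.norm_eq_abs]
    exact mul_le_mul_of_nonneg_left (hb θ (Ico_subset_Icc_self hθ)) (abs_nonneg t))
  simpa [sub_right_comm] using this

/-- Difference quotients with moving base point and moving direction converge to the directional
derivative, provided that the latter is continuous along these data. -/
theorem tendsto_slope_of_tendsto_lineDeriv {f : E → F} {v₀ y₀ : E} {c : F} {l : Filter ℝ}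
    (hl : l ≤ 𝓝[≠] 0) {v y : ℝ → E} (hv : Tendsto v l (𝓝 v₀)) (hy : Tendsto y l (𝓝 y₀))
    (hd : ∀ᶠ w in 𝓝 v₀, ∀ t, LineDifferentiableAt ℝ f w (y t))
    (hc : Tendsto (fun p : E × ℝ => lineDeriv ℝ f p.1 (y p.2)) (𝓝 v₀ ×ˢ l) (𝓝 c)) :
    Tendsto (fun t : ℝ => t⁻¹ • (f (v t + t • y t) - f (v t))) l (𝓝 c) := by
  have h0 : Tendsto (fun t : ℝ => t) l (𝓝 0) := hl.trans nhdsWithin_le_nhds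
  have hne : ∀ᶠ t in l, t ≠ 0 := hl self_mem_nhdsWithin
  rw [Metric.tendsto_nhds]
  intro ε hε
  have h1 : ∀ᶠ p in 𝓝 v₀ ×ˢ l, dist (lineDeriv ℝ f p.1 (y p.2)) c < ε / 2 :=
    (Metric.tendsto_nhds.1 hc) _ (half_pos hε)
  obtain ⟨pa, ha, pb, hb, hab⟩ := eventually_prod_iff.1 h1
  obtain ⟨r, hr, hball⟩ := Metric.eventually_nhds_iff_ball.1 (ha.and hd)
  have h2 : ∀ᶠ t in l, dist (v t) v₀ < r / 2 := (Metric.tendsto_nhds.1 hv) _ (half_pos hr)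
  have h3 : ∀ᶠ t in l, ‖t • y t‖ < r / 2 := by
    have : Tendsto (fun t => ‖t • y t‖) l (𝓝 0) := by simpa using (h0.smul hy).norm
    exact this.eventually (gt_mem_nhds (half_pos hr))
  filter_upwards [hb, h2, h3, hne] with t hbt h2t h3t ht
  have hmem : ∀ θ ∈ Icc (0 : ℝ) 1, v t + (θ * t) • y t ∈ Metric.ball v₀ r := by
    intro θ hθ
    rw [Metric.mem_ball, dist_eq_norm]
    have e1 : ‖(θ * t) • y t‖ ≤ ‖t • y t‖ := by
      rw [mul_smul, norm_smul θ, Real.norm_of_nonneg hθ.1]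
      exact mul_le_of_le_one_left (norm_nonneg _) hθ.2
    calc ‖v t + (θ * t) • y t - v₀‖ = ‖(v t - v₀) + (θ * t) • y t‖ := by congr 1; abel
      _ ≤ ‖v t - v₀‖ + ‖(θ * t) • y t‖ := norm_add_le _ _
      _ < r / 2 + r / 2 := add_lt_add (by rwa [← dist_eq_norm]) (e1.trans_lt h3t)
      _ = r := add_halves r
  have := norm_sub_sub_smul_le_of_lineDeriv (c := c) (ε := ε / 2)
    (fun θ hθ => (hball _ (hmem θ hθ)).2 t)
    (fun θ hθ => by
      rw [← dist_eq_norm]; exact (hab (hball _ (hmem θ hθ)).1 hbt).le)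
  rw [dist_eq_norm]
  have e : t⁻¹ • (f (v t + t • y t) - f (v t)) - c
      = t⁻¹ • (f (v t + t • y t) - f (v t) - t • c) := by
    rw [smul_sub t⁻¹ _ (t • c), inv_smul_smul₀ ht]
  rw [e, norm_smul, norm_inv, Real.norm_eq_abs]
  calc |t|⁻¹ * _ ≤ |t|⁻¹ * (|t| * (ε / 2)) := by gcongr
    _ = ε / 2 := by rw [inv_mul_cancel_left₀ (abs_ne_zero.2 ht)]
    _ < ε := half_lt_self hε

theorem tendsto_slope_of_continuousOn_lineDeriv (hV : IsOpen V) {f : E → F} {v₀ y : E}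
    (hv₀ : v₀ ∈ V) (hd : ∀ w ∈ V, LineDifferentiableAt ℝ f w y)
    (hc : ContinuousOn (fun w => lineDeriv ℝ f w y) V) {v : ℝ → E}
    (hv : Tendsto v (𝓝[≠] 0) (𝓝 v₀)) :
    Tendsto (fun t : ℝ => t⁻¹ • (f (v t + t • y) - f (v t))) (𝓝[≠] 0)
      (𝓝 (lineDeriv ℝ f v₀ y)) := by
  refine tendsto_slope_of_tendsto_lineDeriv le_rfl hv (y := fun _ => y) tendsto_const_nhds ?_ ?_
  · filter_upwards [hV.mem_nhds hv₀] with w hw _ using hd w hw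
  · exact (hc.continuousAt (hV.mem_nhds hv₀)).tendsto.comp tendsto_fst

theorem tendsto_add_smul_nhdsNE (v x : E) :
    Tendsto (fun t : ℝ => v + t • x) (𝓝[≠] 0) (𝓝 v) := by
  have : Tendsto (fun t : ℝ => v + t • x) (𝓝 0) (𝓝 (v + (0 : ℝ) • x)) :=
    Continuous.tendsto (by fun_prop) 0
  simpa using this.mono_left nhdsWithin_le_nhds

/-- Directional derivatives add up if one of the two is continuous in the base point. -/
theorem HasLineDerivAt.add_of_continuousOn (hV : IsOpen V) {f : E → F} {v x y : E} {c : F}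
    (hv : v ∈ V) (hx : HasLineDerivAt ℝ f c v x) (hd : ∀ w ∈ V, LineDifferentiableAt ℝ f w y)
    (hc : ContinuousOn (fun w => lineDeriv ℝ f w y) V) :
    HasLineDerivAt ℝ f (c + lineDeriv ℝ f v y) v (x + y) := by
  rw [hasLineDerivAt_iff_tendsto_slope_zero]
  have h1 := hx.tendsto_slope_zero
  have h2 := tendsto_slope_of_continuousOn_lineDeriv hV hv hd hc (tendsto_add_smul_nhdsNE v x)
  refine (h1.add h2).congr fun t => ?_
  rw [← smul_add, smul_add t x y, add_assoc v]
  congr 1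
  abel

/-- Schwarz's theorem for directional derivatives. -/
theorem lineDeriv_lineDeriv_comm (hV : IsOpen V) {f : E → F} {x y : E}
    (hx : ∀ v ∈ V, LineDifferentiableAt ℝ f v x) (hy : ∀ v ∈ V, LineDifferentiableAt ℝ f v y)
    (hxy : ∀ v ∈ V, LineDifferentiableAt ℝ (fun u => lineDeriv ℝ f u x) v y)
    (hyx : ∀ v ∈ V, LineDifferentiableAt ℝ (fun u => lineDeriv ℝ f u y) v x)
    (cxy : ContinuousOn (fun v => lineDeriv ℝ (fun u => lineDeriv ℝ f u x) v y) V)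
    (cyx : ContinuousOn (fun v => lineDeriv ℝ (fun u => lineDeriv ℝ f u y) v x) V)
    {v : E} (hv : v ∈ V) :
    lineDeriv ℝ (fun u => lineDeriv ℝ f u x) v y = lineDeriv ℝ (fun u => lineDeriv ℝ f u y) v x := by
  -- each mixed derivative approximates the same second difference
  have key : ∀ {x y : E}, (∀ v ∈ V, LineDifferentiableAt ℝ f v x) →
      (∀ v ∈ V, LineDifferentiableAt ℝ (fun u => lineDeriv ℝ f u x) v y) →
      ∀ {c : F} {r t ε : ℝ}, 0 ≤ t → t * (‖x‖ + ‖y‖) < r → (Metric.ball v r ⊆ V) →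
      (∀ w ∈ Metric.ball v r, ‖lineDeriv ℝ (fun u => lineDeriv ℝ f u x) w y - c‖ ≤ ε) →
      ‖f (v + t • x + t • y) - f (v + t • x) - (f (v + t • y) - f v) - t • t • c‖
        ≤ t * (t * ε) := by
    intro x y hx hxy c r t ε ht htr hr hc
    have hmem : ∀ a ∈ Icc (0 : ℝ) 1, ∀ b ∈ Icc (0 : ℝ) 1,
        v + (a * t) • x + (b * t) • y ∈ Metric.ball v r := by
      intro a ha b hb
      rw [Metric.mem_ball, dist_eq_norm]
      have e1 : ‖(a * t) • x‖ ≤ t * ‖x‖ := by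
        rw [norm_smul, Real.norm_of_nonneg (mul_nonneg ha.1 ht)]
        exact mul_le_mul_of_nonneg_right (mul_le_of_le_one_left ht ha.2) (norm_nonneg _)
      have e2 : ‖(b * t) • y‖ ≤ t * ‖y‖ := by
        rw [norm_smul, Real.norm_of_nonneg (mul_nonneg hb.1 ht)]
        exact mul_le_mul_of_nonneg_right (mul_le_of_le_one_left ht hb.2) (norm_nonneg _)
      calc ‖v + (a * t) • x + (b * t) • y - v‖ = ‖(a * t) • x + (b * t) • y‖ := by congr 1; abel
        _ ≤ _ := norm_add_le _ _
        _ ≤ t * (‖x‖ + ‖y‖) := by linarith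
        _ < r := htr
    have hmem' : ∀ a ∈ Icc (0 : ℝ) 1, v + (a * t) • x ∈ V ∧ v + (a * t) • x + t • y ∈ V := by
      intro a ha
      have h0 := hr (hmem a ha 0 (by simp))
      have h1 := hr (hmem a ha 1 (by simp))
      simp only [zero_mul, zero_smul, add_zero, one_mul] at h0 h1
      exact ⟨h0, h1⟩
    have hder : ∀ a ∈ Icc (0 : ℝ) 1, HasLineDerivAt ℝ (fun w => f (w + t • y) - f w)
        (lineDeriv ℝ f (v + (a * t) • x + t • y) x - lineDeriv ℝ f (v + (a * t) • x) x)
        (v + (a * t) • x) x := by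
      intro a ha
      have h1 := (hx _ (hmem' a ha).2).hasLineDerivAt
      have h0 := (hx _ (hmem' a ha).1).hasLineDerivAt
      unfold HasLineDerivAt at h0 h1 ⊢
      refine HasDerivAt.sub (h1.congr_of_eventuallyEq (Eventually.of_forall fun s => ?_)) h0
      simp only
      congr 1
      abel
    have := norm_sub_sub_smul_le_of_lineDeriv (f := fun w => f (w + t • y) - f w) (v := v) (y := x)
      (t := t) (c := t • c) (ε := t * ε) (fun a ha => (hder a ha).lineDifferentiableAt)
      (fun a ha => by
        rw [(hder a ha).lineDeriv]
        have h2 := norm_sub_sub_smul_le_of_lineDeriv (f := fun u => lineDeriv ℝ f u x)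
          (v := v + (a * t) • x) (y := y) (t := t) (c := c) (ε := ε)
          (fun b hb => hxy _ (hr (hmem a ha b hb))) (fun b hb => hc _ (hmem a ha b hb))
        rwa [abs_of_nonneg ht] at h2)
    rwa [abs_of_nonneg ht] at this
  refine eq_of_forall_dist_le fun ε hε => ?_
  have hnx := (Metric.tendsto_nhds.1 (cxy.continuousAt (hV.mem_nhds hv)).tendsto) _ (half_pos hε)
  have hny := (Metric.tendsto_nhds.1 (cyx.continuousAt (hV.mem_nhds hv)).tendsto) _ (half_pos hε)
  obtain ⟨r, hr, hball⟩ := Metric.eventually_nhds_iff_ball.1 ((hnx.and hny).and (hV.mem_nhds hv))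
  have hpos : 0 < ‖x‖ + ‖y‖ + 1 := by positivity
  obtain ⟨t, ht, htr⟩ : ∃ t : ℝ, 0 < t ∧ t * (‖x‖ + ‖y‖) < r := by
    refine ⟨r / (‖x‖ + ‖y‖ + 1), by positivity, ?_⟩
    rw [div_mul_eq_mul_div, div_lt_iff₀ hpos]
    exact mul_lt_mul_of_pos_left (lt_add_one _) hr
  have k1 := key hx hxy ht.le htr (fun w hw => (hball w hw).2)
    (c := lineDeriv ℝ (fun u => lineDeriv ℝ f u x) v y) (ε := ε / 2)
    (fun w hw => by rw [← dist_eq_norm]; exact (hball w hw).1.1.le)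
  have k2 := key hy hyx ht.le (by rwa [add_comm]) (fun w hw => (hball w hw).2)
    (c := lineDeriv ℝ (fun u => lineDeriv ℝ f u y) v x) (ε := ε / 2)
    (fun w hw => by rw [← dist_eq_norm]; exact (hball w hw).1.2.le)
  set c := lineDeriv ℝ (fun u => lineDeriv ℝ f u x) v y
  set c' := lineDeriv ℝ (fun u => lineDeriv ℝ f u y) v x
  have e : t • t • (c - c') =
      (f (v + t • y + t • x) - f (v + t • y) - (f (v + t • x) - f v) - t • t • c')
      - (f (v + t • x + t • y) - f (v + t • x) - (f (v + t • y) - f v) - t • t • c) := by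
    rw [add_right_comm v, smul_sub, smul_sub]
    abel
  have h2 : ‖t • t • (c - c')‖ ≤ t * (t * ε) := by
    rw [e]
    refine (norm_sub_le _ _).trans ((add_le_add k2 k1).trans_eq ?_)
    ring
  rw [norm_smul, norm_smul, Real.norm_of_nonneg ht.le] at h2
  rw [dist_eq_norm]
  exact le_of_mul_le_mul_left (le_of_mul_le_mul_left h2 ht) ht

end IteratedDerivatives

/-! ### Continuous directional derivatives and the spaces `GSpace` -/

/-- All iterated directional derivatives of `f` of order at most `n` with increments in `E₀`
(embedded by `ι`) exist on `V` and are continuous there, for fixed increments. For complete `E₀`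
and open `V` this is equivalent to `GSpace n ι V f`, multilinearity and separate continuity of the
derivatives being automatic. -/
def ContGateaux {E₀ E F : Type*} [NormedAddCommGroup E₀] [NormedSpace ℝ E₀]
    [NormedAddCommGroup E] [NormedSpace ℝ E] [NormedAddCommGroup F] [NormedSpace ℝ F]
    (n : ℕ) (ι : E₀ →L[ℝ] E) (V : Set E) (f : E → F) : Prop :=
  ∀ L : List E₀, L.length ≤ n →
    DirDerivExistsOn V f (L.map ι) ∧ ContinuousOn (iterDirDeriv f (L.map ι)) V

namespace ContGateaux

variable {E₀ E F G : Type*} [NormedAddCommGroup E₀] [NormedSpace ℝ E₀]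
  [NormedAddCommGroup E] [NormedSpace ℝ E] [NormedAddCommGroup F] [NormedSpace ℝ F]
  [NormedAddCommGroup G] [NormedSpace ℝ G]
  {n m : ℕ} {ι : E₀ →L[ℝ] E} {V : Set E} {f g : E → F}

theorem mono (hf : ContGateaux n ι V f) (hm : m ≤ n) : ContGateaux m ι V f :=
  fun L hL => hf L (hL.trans hm)

theorem continuousOn (hf : ContGateaux n ι V f) : ContinuousOn f V :=
  (hf [] (Nat.zero_le _)).2

theorem iterate (hf : ContGateaux n ι V f) (L : List E₀) (h : L.length + m ≤ n) :
    ContGateaux m ι V (iterDirDeriv f (L.map ι)) := by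
  intro L' hL'
  have := hf (L ++ L') (by rw [List.length_append]; omega)
  rw [List.map_append, dirDerivExistsOn_append, iterDirDeriv_append] at this
  exact ⟨this.1.2, this.2⟩

theorem congr (hV : IsOpen V) (hf : ContGateaux n ι V f) (h : EqOn f g V) :
    ContGateaux n ι V g := fun L hL =>
  ⟨(hf L hL).1.congr hV h, (hf L hL).2.congr (eqOn_iterDirDeriv hV h _).symm⟩

theorem clm_comp (hV : IsOpen V) (hf : ContGateaux n ι V f) (A : F →L[ℝ] G) :
    ContGateaux n ι V (fun u => A (f u)) := fun L hL =>
  ⟨((hf L hL).1.clm_comp hV A).1,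
    (A.continuous.comp_continuousOn (hf L hL).2).congr ((hf L hL).1.clm_comp hV A).2⟩

theorem lineDifferentiableAt (hf : ContGateaux n ι V f) (hn : 1 ≤ n) {v : E} (hv : v ∈ V)
    (x : E₀) : LineDifferentiableAt ℝ f v (ι x) :=
  (hf [x] (by simpa using hn)).1.1 v hv

theorem continuousOn_lineDeriv (hf : ContGateaux n ι V f) (hn : 1 ≤ n) (x : E₀) :
    ContinuousOn (fun v => lineDeriv ℝ f v (ι x)) V :=
  (hf [x] (by simpa using hn)).2

theorem lineDeriv_add (hf : ContGateaux n ι V f) (hV : IsOpen V) (hn : 1 ≤ n) {v : E} (hv : v ∈ V)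
    (x y : E₀) :
    lineDeriv ℝ f v (ι (x + y)) = lineDeriv ℝ f v (ι x) + lineDeriv ℝ f v (ι y) := by
  rw [map_add]
  exact (HasLineDerivAt.add_of_continuousOn hV hv (hf.lineDifferentiableAt hn hv x).hasLineDerivAt
    (fun w hw => hf.lineDifferentiableAt hn hw y) (hf.continuousOn_lineDeriv hn y)).lineDeriv

/-- The order of differentiation is immaterial. -/
theorem eqOn_of_perm (hf : ContGateaux n ι V f) (hV : IsOpen V) {L L' : List E₀}
    (hLL' : L.Perm L') (hL : L.length ≤ n) :
    EqOn (iterDirDeriv f (L.map ι)) (iterDirDeriv f (L'.map ι)) V := by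
  induction hLL' generalizing n f with
  | nil => exact fun _ _ => rfl
  | @cons x l l' _ ih =>
    rw [List.length_cons] at hL
    have h1 : ContGateaux (n - 1) ι V (iterDirDeriv f ([x].map ι)) :=
      hf.iterate [x] (by rw [List.length_singleton]; omega)
    exact ih h1 (by omega)
  | swap x y l =>
    simp only [List.length_cons] at hL
    have h1 := hf.iterate [x] (m := 1) (by simp; omega)
    have h2 := hf.iterate [y] (m := 1) (by simp; omega)
    have h3 : EqOn (iterDirDeriv f [ι y, ι x]) (iterDirDeriv f [ι x, ι y]) V := fun v hv =>
      lineDeriv_lineDeriv_comm hV (fun v hv => hf.lineDifferentiableAt (by omega) hv y)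
      (fun v hv => hf.lineDifferentiableAt (by omega) hv x)
      (fun v hv => h2.lineDifferentiableAt le_rfl hv x)
      (fun v hv => h1.lineDifferentiableAt le_rfl hv y)
      (h2.continuousOn_lineDeriv le_rfl x) (h1.continuousOn_lineDeriv le_rfl y) hv
    exact eqOn_iterDirDeriv hV h3 (l.map ι)
  | trans h1 _ ih1 ih2 => exact (ih1 hf hL).trans (ih2 hf (h1.length_eq ▸ hL))

end ContGateaux

section GSpace

variable {E₀ E F : Type*} [NormedAddCommGroup E₀] [NormedSpace ℝ E₀]
  [NormedAddCommGroup E] [NormedSpace ℝ E] [NormedAddCommGroup F] [NormedSpace ℝ F]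
  {n : ℕ} {ι : E₀ →L[ℝ] E} {V : Set E} {f : E → F}

theorem GSpace.contGateaux (h : GSpace n ι V f) (hV : IsOpen V) : ContGateaux n ι V f := by
  obtain ⟨hf, D, hD0, hD⟩ := h
  have heval : ∀ k (m : Fin k → E₀), Continuous fun Λ : SepContMultilinear k E₀ F => Λ.1 m :=
    fun k m => (continuous_apply m).comp continuous_induced_dom
  have key : ∀ k ≤ n, ∀ m : Fin k → E₀, DirDerivExistsOn V f ((List.ofFn m).map ι) ∧
      EqOn (iterDirDeriv f ((List.ofFn m).map ι)) (fun u => (D k u).1 m) V := by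
    intro k
    induction k with
    | zero => exact fun _ m => ⟨trivial, fun u hu => (hD0 u hu m).symm⟩
    | succ k ih =>
      intro hk m
      obtain ⟨h1, h2⟩ := ih (by omega) (fun i => m i.castSucc)
      have h3 : ∀ u ∈ V, HasLineDerivAt ℝ (fun u => (D k u).1 fun i => m i.castSucc)
          ((D (k + 1) u).1 m) u (ι (m (Fin.last k))) := by
        intro u hu
        rw [hasLineDerivAt_iff_tendsto_slope_zero]
        have h4 := ((heval k (fun i => m i.castSucc)).tendsto _).comp
          ((hD k (by omega)).1 u hu (m (Fin.last k)))
        have h5 : (sepContCurryLast (D (k + 1) u) (m (Fin.last k))).1 (fun i => m i.castSucc)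
            = (D (k + 1) u).1 m :=
          congrArg (D (k + 1) u).1 (Fin.snoc_init_self m)
        rw [h5] at h4
        exact h4
      have h6 := eqOn_lineDeriv hV h2 (ι (m (Fin.last k)))
      rw [List.ofFn_succ', List.concat_eq_append, List.map_append, dirDerivExistsOn_append,
        iterDirDeriv_append]
      refine ⟨⟨h1, fun u hu => ?_, trivial⟩, fun u hu => ?_⟩
      · exact ((h2.eventuallyEq_of_mem (hV.mem_nhds hu)).lineDifferentiableAt_iff).2
          (h3 u hu).lineDifferentiableAt
      · exact (h6 hu).trans (h3 u hu).lineDeriv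
  intro L hL
  have h1 := key L.length hL L.get
  rw [List.ofFn_get] at h1
  refine ⟨h1.1, ContinuousOn.congr ?_ h1.2⟩
  rcases L with _ | ⟨x, l⟩
  · exact hf.congr fun u hu => hD0 u hu _
  · exact (heval _ _).comp_continuousOn (hD l.length (by simpa using hL)).2

end GSpace

section Baire

variable {E₀ E F : Type*} [NormedAddCommGroup E₀] [NormedSpace ℝ E₀] [CompleteSpace E₀]
  [NormedAddCommGroup E] [NormedSpace ℝ E] [NormedAddCommGroup F] [NormedSpace ℝ F]
  {n : ℕ} {ι : E₀ →L[ℝ] E} {V : Set E} {f : E → F}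

/-- If the directional derivative of a continuous function is linear in the direction, then it is
continuous in the direction: it is a pointwise limit of continuous functions on a Baire space. -/
theorem continuous_of_hasLineDerivAt (hV : IsOpen V) (hf : ContinuousOn f V) {v : E} (hv : v ∈ V)
    (T : E₀ →ₗ[ℝ] F) (hT : ∀ x, HasLineDerivAt ℝ f (T x) v (ι x)) : Continuous T := by
  obtain ⟨r, hr, hball⟩ := Metric.nhds_basis_closedBall.mem_iff.1 (hV.mem_nhds hv)
  let s : ℕ → ℝ := fun k => 1 / ((k : ℝ) + 1)
  have hs0 : Tendsto s atTop (𝓝 0) := tendsto_one_div_add_atTop_nhds_zero_nat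
  have hspos : ∀ k, 0 < s k := fun k => Nat.one_div_pos_of_nat
  have hs : Tendsto s atTop (𝓝[≠] 0) :=
    tendsto_nhdsWithin_iff.2 ⟨hs0, Eventually.of_forall fun k => (hspos k).ne'⟩
  let g : ℕ → E₀ → F := fun k x => (s k)⁻¹ • (f (v + s k • ι x) - f v)
  have hg : ∀ x, Tendsto (fun k => g k x) atTop (𝓝 (T x)) := fun x =>
    (hT x).tendsto_slope_zero.comp hs
  let A : ℕ → Set E₀ := fun k => {x | v + s k • ι x ∈ Metric.closedBall v r}
  have hA : ∀ k, IsClosed (A k) := fun k =>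
    Metric.isClosed_closedBall.preimage (by fun_prop)
  have hgc : ∀ k, ContinuousOn (g k) (A k) := fun k =>
    ((hf.comp (t := V) (f := fun x => v + s k • ι x) (by fun_prop) fun x hx => hball hx).sub
      continuousOn_const).const_smul ((s k)⁻¹)
  let C : ℕ → Set E₀ := fun M => ⋂ k ≥ M, A k ∩ g k ⁻¹' Metric.closedBall 0 (M : ℝ)
  have hC : ∀ M, IsClosed (C M) := fun M => isClosed_biInter fun k _ =>
    (hgc k).preimage_isClosed_of_isClosed (hA k) Metric.isClosed_closedBall
  have hU : ⋃ M, C M = univ := by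
    refine eq_univ_of_forall fun x => mem_iUnion.2 ?_
    have h1 : ∀ᶠ k in atTop, x ∈ A k := by
      have : Tendsto (fun k => v + s k • ι x) atTop (𝓝 v) :=
        (tendsto_add_smul_nhdsNE v (ι x)).comp hs
      exact this.eventually (Metric.closedBall_mem_nhds v hr)
    have h2 : ∀ᶠ k in atTop, ‖g k x‖ < ‖T x‖ + 1 := (hg x).norm.eventually (gt_mem_nhds (lt_add_one _))
    obtain ⟨N, hN⟩ := eventually_atTop.1 (h1.and h2)
    obtain ⟨M', hM'⟩ := exists_nat_ge (‖T x‖ + 1)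
    refine ⟨max N M', mem_iInter₂.2 fun k hk => ?_⟩
    obtain ⟨h3, h4⟩ := hN k ((le_max_left _ _).trans hk)
    refine ⟨h3, ?_⟩
    rw [mem_preimage, mem_closedBall_zero_iff]
    refine h4.le.trans (hM'.trans ?_)
    exact_mod_cast le_max_right _ _
  obtain ⟨M, x₀, hx₀⟩ := nonempty_interior_of_iUnion_of_closed hC hU
  have hbound : ∀ x ∈ C M, ‖T x‖ ≤ M := fun x hx => by
    refine le_of_tendsto (hg x).norm (eventually_atTop.2 ⟨M, fun k hk => ?_⟩)
    simpa using (mem_iInter₂.1 hx k hk).2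
  obtain ⟨ρ, hρ, hρC⟩ := Metric.isOpen_iff.1 isOpen_interior x₀ hx₀
  obtain ⟨K, hK⟩ := LinearMap.bound_of_ball_bound (𝕜 := ℝ) hρ (M + M : ℝ) T (fun z hz => by
    have h1 : x₀ + z ∈ C M := interior_subset (hρC (by simpa using hz))
    have h2 : T z = T (x₀ + z) - T x₀ := by simp
    rw [h2]
    exact (norm_sub_le _ _).trans (add_le_add (hbound _ h1) (hbound _ (interior_subset hx₀))))
  exact (T.mkContinuous K hK).continuous

theorem ContGateaux.exists_clm (hf : ContGateaux n ι V f) (hV : IsOpen V) (hn : 1 ≤ n) {v : E}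
    (hv : v ∈ V) : ∃ T : E₀ →L[ℝ] F, ∀ x, T x = lineDeriv ℝ f v (ι x) := by
  let T : E₀ →ₗ[ℝ] F :=
    { toFun := fun x => lineDeriv ℝ f v (ι x)
      map_add' := hf.lineDeriv_add hV hn hv
      map_smul' := fun c x => by rw [map_smul, lineDeriv_smul]; rfl }
  exact ⟨⟨T, continuous_of_hasLineDerivAt hV hf.continuousOn hv T fun x =>
    (hf.lineDifferentiableAt hn hv x).hasLineDerivAt⟩, fun _ => rfl⟩


/-- All arguments but the `i`-th of an `n`-tuple, followed by the `i`-th. -/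
theorem ofFn_update_perm {α : Type*} {k : ℕ} (m : Fin k → α) (i : Fin k) :
    ∃ R : List α, R.length + 1 = k ∧
      ∀ z, (List.ofFn (Function.update m i z)).Perm (R ++ [z]) := by
  refine ⟨(List.ofFn m).take i ++ (List.ofFn m).drop (i + 1), ?_, fun z => ?_⟩
  · have := i.isLt
    simp; omega
  · have h1 : List.ofFn (Function.update m i z) = (List.ofFn m).set i z := by
      refine List.ext_getElem (by simp) fun j h1 h2 => ?_
      simp only [List.getElem_ofFn, List.getElem_set, Function.update_apply, Fin.ext_iff, eq_comm]
    have h2 : (i : ℕ) < (List.ofFn m).length := by simp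
    rw [h1, List.set_eq_take_append_cons_drop, if_pos h2]
    exact List.perm_middle.trans (List.perm_append_singleton _ _).symm

theorem ContGateaux.gspace (hf : ContGateaux n ι V f) (hV : IsOpen V) : GSpace n ι V f := by
  classical
  have key : ∀ k ≤ n, ∀ u ∈ V, ∃ Λ : SepContMultilinear k E₀ F,
      ∀ m, Λ.1 m = iterDirDeriv f ((List.ofFn m).map ι) u := by
    intro k hk u hu
    have h1 : ∀ (m : Fin k → E₀) (i : Fin k), ∃ T : E₀ →L[ℝ] F, ∀ z,
        iterDirDeriv f ((List.ofFn (Function.update m i z)).map ι) u = T z := by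
      intro m i
      obtain ⟨R, hR, hRm⟩ := ofFn_update_perm m i
      obtain ⟨T, hT⟩ := (hf.iterate R (m := 1) (by omega)).exists_clm hV le_rfl hu
      refine ⟨T, fun z => ?_⟩
      rw [hf.eqOn_of_perm hV (hRm z) (by simpa using hk) hu, List.map_append, iterDirDeriv_append,
        hT]
      rfl
    refine ⟨⟨{ toFun := fun m => iterDirDeriv f ((List.ofFn m).map ι) u
               map_update_add' := ?_
               map_update_smul' := ?_ }, ?_⟩, fun _ => rfl⟩
    · intro inst m i x y
      obtain rfl : inst = instDecidableEqFin k := Subsingleton.elim _ _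
      obtain ⟨T, hT⟩ := h1 m i
      rw [hT, hT, hT, map_add]
    · intro inst m i c x
      obtain rfl : inst = instDecidableEqFin k := Subsingleton.elim _ _
      obtain ⟨T, hT⟩ := h1 m i
      rw [hT, hT, map_smul]
    · intro m i
      obtain ⟨T, hT⟩ := h1 m i
      exact T.continuous.congr fun z => (hT z).symm
  choose! D hD using key
  refine ⟨hf.continuousOn, D, fun u hu m => ?_, fun k hk => ⟨fun u hu x => ?_, ?_⟩⟩
  · rw [hD 0 (Nat.zero_le _) u hu]
    simp [iterDirDeriv]
  · unfold HasDirDerivAt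
    rw [nhds_induced, tendsto_comap_iff, tendsto_pi_nhds]
    intro m
    have h1 : (sepContCurryLast (D (k + 1) u) x).1 m
        = lineDeriv ℝ (iterDirDeriv f ((List.ofFn m).map ι)) u (ι x) := by
      have h2 : (sepContCurryLast (D (k + 1) u) x).1 m = (D (k + 1) u).1 (Fin.snoc m x) := rfl
      rw [h2, hD (k + 1) hk u hu, List.ofFn_succ', List.concat_eq_append, List.map_append,
        iterDirDeriv_append]
      simp [iterDirDeriv]
    have h2 := ((hf.iterate (List.ofFn m) (m := 1) (by simpa using hk)).lineDifferentiableAt le_rfl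
      hu x).hasLineDerivAt.tendsto_slope_zero
    rw [h1]
    refine h2.congr' ?_
    filter_upwards [(tendsto_add_smul_nhdsNE u (ι x)).eventually (hV.mem_nhds hu)] with t ht
    have h3 : (t⁻¹ • (D k (u + t • ι x) - D k u)).1 m
      = t⁻¹ • ((D k (u + t • ι x)).1 m - (D k u).1 m) := rfl
    rw [Function.comp, h3, hD k hk.le _ ht, hD k hk.le _ hu]
  · have hind : IsInducing fun (Λ : SepContMultilinear (k + 1) E₀ F) m => Λ.1 m := ⟨rfl⟩
    refine hind.continuousOn_iff.2 (continuousOn_pi.2 fun m => ?_)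
    exact ((hf (List.ofFn m) (by simpa using hk)).2).congr fun u hu => hD _ hk u hu m

end Baire

/-! ### Joint continuity of the derivatives and the chain rule -/

/-- If continuous linear maps on a Banach space converge pointwise along a sequence, then they may
be evaluated at a convergent sequence (Banach–Steinhaus). -/
theorem tendsto_clm_apply_of_pointwise {E₀ F : Type*} [NormedAddCommGroup E₀] [NormedSpace ℝ E₀]
    [CompleteSpace E₀] [NormedAddCommGroup F] [NormedSpace ℝ F] {T : ℕ → E₀ →L[ℝ] F} {S : E₀ → F}
    (h : ∀ e, Tendsto (fun k => T k e) atTop (𝓝 (S e))) {e : ℕ → E₀} {e₀ : E₀}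
    (he : Tendsto e atTop (𝓝 e₀)) : Tendsto (fun k => T k (e k)) atTop (𝓝 (S e₀)) := by
  obtain ⟨C, hC⟩ := banach_steinhaus (g := T) fun x => by
    obtain ⟨C, hC⟩ := (h x).norm.bddAbove_range
    exact ⟨C, fun i => hC ⟨i, rfl⟩⟩
  have h1 : Tendsto (fun k => C * ‖e k - e₀‖) atTop (𝓝 0) := by
    simpa using (tendsto_iff_norm_sub_tendsto_zero.1 he).const_mul C
  have h2 : Tendsto (fun k => T k (e k - e₀)) atTop (𝓝 0) :=
    squeeze_zero_norm (fun k => (T k).le_of_opNorm_le (hC k) _) h1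
  simpa using h2.add (h e₀)

/-- The derivative of `f` with respect to a multiset of increments from `E₀`, meaningful when the
order of differentiation is immaterial. -/
noncomputable def multiDeriv {E₀ E F : Type*} [NormedAddCommGroup E₀] [NormedSpace ℝ E₀]
    [NormedAddCommGroup E] [NormedSpace ℝ E] [NormedAddCommGroup F] [NormedSpace ℝ F]
    (ι : E₀ →L[ℝ] E) (f : E → F) (M : Multiset E₀) : E → F :=
  iterDirDeriv f (M.toList.map ι)

namespace ContGateaux

variable {E₀ E F : Type*} [NormedAddCommGroup E₀] [NormedSpace ℝ E₀]
  [NormedAddCommGroup E] [NormedSpace ℝ E] [NormedAddCommGroup F] [NormedSpace ℝ F]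
  {n m : ℕ} {ι : E₀ →L[ℝ] E} {V : Set E} {f : E → F}

theorem multiDeriv_coe (hf : ContGateaux n ι V f) (hV : IsOpen V) {L : List E₀}
    {M : Multiset E₀} (hM : M = L) (hL : L.length ≤ n) :
    EqOn (multiDeriv ι f M) (iterDirDeriv f (L.map ι)) V := by
  have h : M.toList.Perm L := by rw [← Multiset.coe_eq_coe, Multiset.coe_toList, hM]
  exact hf.eqOn_of_perm hV h (h.length_eq ▸ hL)

theorem multiDeriv_cons (hf : ContGateaux n ι V f) (hV : IsOpen V) {M : Multiset E₀}
    (hM : M.card + 1 ≤ n) (e : E₀) {v : E} (hv : v ∈ V) :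
    multiDeriv ι f (e ::ₘ M) v = lineDeriv ℝ (multiDeriv ι f M) v (ι e) := by
  have h : e ::ₘ M = ((M.toList ++ [e] : List E₀) : Multiset E₀) := by
    rw [← Multiset.coe_add, Multiset.coe_toList, Multiset.coe_singleton, add_comm,
      Multiset.singleton_add]
  rw [hf.multiDeriv_coe hV h (by simpa using hM) hv, List.map_append, iterDirDeriv_append]
  rfl

theorem contGateaux_multiDeriv (hf : ContGateaux n ι V f) (M : Multiset E₀) (h : M.card + m ≤ n) :
    ContGateaux m ι V (multiDeriv ι f M) :=
  hf.iterate M.toList (by simpa using h)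

variable [CompleteSpace E₀]

theorem exists_clm_multiDeriv (hf : ContGateaux n ι V f) (hV : IsOpen V) {M : Multiset E₀}
    (hM : M.card + 1 ≤ n) {v : E} (hv : v ∈ V) :
    ∃ T : E₀ →L[ℝ] F, ∀ e, T e = multiDeriv ι f (e ::ₘ M) v := by
  obtain ⟨T, hT⟩ := (hf.contGateaux_multiDeriv M hM).exists_clm hV le_rfl hv
  exact ⟨T, fun e => by rw [hT, hf.multiDeriv_cons hV hM e hv]⟩

theorem tendsto_multiDeriv_seq (hf : ContGateaux n ι V f) (hV : IsOpen V) {κ : Type*}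
    (Q : Finset κ) {ξ : ℕ → κ → E₀} {ξ₀ : κ → E₀}
    (hξ : ∀ q ∈ Q, Tendsto (fun k => ξ k q) atTop (𝓝 (ξ₀ q))) {v : ℕ → E} {v₀ : E}
    (hv : Tendsto v atTop (𝓝 v₀)) (hv₀ : v₀ ∈ V) (M : Multiset E₀) (hM : M.card + Q.card ≤ n) :
    Tendsto (fun k => multiDeriv ι f (M + Q.val.map (ξ k)) (v k)) atTop
      (𝓝 (multiDeriv ι f (M + Q.val.map ξ₀) v₀)) := by
  classical
  induction Q using Finset.induction generalizing M with
  | empty =>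
    simp only [Finset.empty_val, Multiset.map_zero, add_zero]
    exact ((hf.contGateaux_multiDeriv M (m := 0) (by simpa using hM)).continuousOn.continuousAt
      (hV.mem_nhds hv₀)).tendsto.comp hv
  | @insert q Q hq ih =>
    rw [Finset.card_insert_of_notMem hq] at hM
    simp only [Finset.insert_val_of_notMem hq, Multiset.map_cons, Multiset.add_cons]
    have hex : ∀ k, ∃ T : E₀ →L[ℝ] F, v k ∈ V →
        ∀ e, T e = multiDeriv ι f (e ::ₘ (M + Q.val.map (ξ k))) (v k) := by
      intro k
      by_cases hk : v k ∈ V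
      · obtain ⟨T, hT⟩ := hf.exists_clm_multiDeriv hV (M := M + Q.val.map (ξ k))
          (by simp; omega) hk
        exact ⟨T, fun _ => hT⟩
      · exact ⟨0, fun h => absurd h hk⟩
    choose T hT using hex
    have hvV : ∀ᶠ k in atTop, v k ∈ V := hv.eventually (hV.mem_nhds hv₀)
    have h1 : ∀ e, Tendsto (fun k => T k e) atTop
        (𝓝 (multiDeriv ι f (e ::ₘ (M + Q.val.map ξ₀)) v₀)) := by
      intro e
      have := ih (fun q' hq' => hξ q' (Finset.mem_insert_of_mem hq')) (e ::ₘ M)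
        (by rw [Multiset.card_cons]; omega)
      simp only [Multiset.cons_add] at this
      refine this.congr' ?_
      filter_upwards [hvV] with k hk using (hT k hk e).symm
    refine (tendsto_clm_apply_of_pointwise h1 (hξ q (Finset.mem_insert_self _ _))).congr' ?_
    filter_upwards [hvV] with k hk using hT k hk _

/-- The derivatives are jointly continuous in the base point and the increments. -/
theorem tendsto_multiDeriv (hf : ContGateaux n ι V f) (hV : IsOpen V) {κ τ : Type*}
    {l : Filter τ} [l.IsCountablyGenerated]
    (Q : Finset κ) {ξ : τ → κ → E₀} {ξ₀ : κ → E₀}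
    (hξ : ∀ q ∈ Q, Tendsto (fun k => ξ k q) l (𝓝 (ξ₀ q))) {v : τ → E} {v₀ : E}
    (hv : Tendsto v l (𝓝 v₀)) (hv₀ : v₀ ∈ V) (M : Multiset E₀) (hM : M.card + Q.card ≤ n) :
    Tendsto (fun k => multiDeriv ι f (M + Q.val.map (ξ k)) (v k)) l
      (𝓝 (multiDeriv ι f (M + Q.val.map ξ₀) v₀)) :=
  tendsto_of_seq_tendsto fun x hx =>
    hf.tendsto_multiDeriv_seq hV Q (ξ := fun k => ξ (x k)) (fun q hq => (hξ q hq).comp hx)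
      (hv.comp hx) hv₀ M hM

theorem tendsto_multiDeriv_cons (hf : ContGateaux n ι V f) (hV : IsOpen V) {κ τ : Type*}
    {l : Filter τ} [l.IsCountablyGenerated] (Q : Finset κ) {ξ : τ → κ → E₀} {ξ₀ : κ → E₀}
    (hξ : ∀ q ∈ Q, Tendsto (fun k => ξ k q) l (𝓝 (ξ₀ q))) {v : τ → E} {v₀ : E}
    (hv : Tendsto v l (𝓝 v₀)) (hv₀ : v₀ ∈ V) {c : τ → E₀} {c₀ : E₀} (hc : Tendsto c l (𝓝 c₀))
    (M : Multiset E₀) (hM : M.card + Q.card + 1 ≤ n) :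
    Tendsto (fun k => multiDeriv ι f (c k ::ₘ (M + Q.val.map (ξ k))) (v k)) l
      (𝓝 (multiDeriv ι f (c₀ ::ₘ (M + Q.val.map ξ₀)) v₀)) := by
  have := hf.tendsto_multiDeriv hV (Finset.insertNone Q)
    (ξ := fun k o => o.elim (c k) (ξ k)) (ξ₀ := fun o => o.elim c₀ ξ₀) (l := l)
    (by
      rintro (_ | q) hq
      · exact hc
      · exact hξ q (Finset.some_mem_insertNone.1 hq)) hv hv₀ M (by
      rw [Finset.card_insertNone]; omega)
  simpa [Finset.insertNone, Multiset.map_map, Function.comp_def] using this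

/-- Chain rule: the derivative at `t = 0` of `∂_M ∂_{ξ_q(t), q ∈ Q} f (v(t))`, where `v` and the `ξ_q`
are curves with difference quotients `ι (c t)` and `η_q(t)`. -/
theorem tendsto_slope_multiDeriv (hf : ContGateaux n ι V f) (hV : IsOpen V) {κ : Type*}
    [DecidableEq κ] {v₀ : E} (hv₀ : v₀ ∈ V) {c : ℝ → E₀} {c₀ : E₀}
    (hc : Tendsto c (𝓝[≠] 0) (𝓝 c₀)) (ξ₀ : κ → E₀) {η : ℝ → κ → E₀} {η₀ : κ → E₀} (Q : Finset κ)
    (hη : ∀ q ∈ Q, Tendsto (fun t => η t q) (𝓝[≠] 0) (𝓝 (η₀ q)))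
    (M : Multiset E₀) (hM : M.card + Q.card + 1 ≤ n) :
    Tendsto (fun t : ℝ => t⁻¹ •
        (multiDeriv ι f (M + Q.val.map (fun q => ξ₀ q + t • η t q)) (v₀ + t • ι (c t)) -
          multiDeriv ι f (M + Q.val.map ξ₀) v₀)) (𝓝[≠] 0)
      (𝓝 (multiDeriv ι f (c₀ ::ₘ (M + Q.val.map ξ₀)) v₀ +
        ∑ q ∈ Q, multiDeriv ι f (η₀ q ::ₘ (M + (Q.erase q).val.map ξ₀)) v₀)) := by
  have h0 : Tendsto (fun t : ℝ => t) (𝓝[≠] 0) (𝓝 0) := nhdsWithin_le_nhds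
  have hv : Tendsto (fun t : ℝ => v₀ + t • ι (c t)) (𝓝[≠] 0) (𝓝 v₀) := by
    simpa using (h0.smul ((ι.continuous.tendsto _).comp hc)).const_add v₀
  have hvV : ∀ᶠ t : ℝ in 𝓝[≠] 0, v₀ + t • ι (c t) ∈ V := hv.eventually (hV.mem_nhds hv₀)
  have hne : ∀ᶠ t : ℝ in 𝓝[≠] 0, t ≠ 0 := self_mem_nhdsWithin
  induction Q using Finset.induction generalizing M with
  | empty =>
    simp only [Finset.empty_val, Multiset.map_zero, add_zero, Finset.sum_empty]
    rw [Finset.card_empty, add_zero] at hM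
    have hg : ContGateaux 1 ι V (multiDeriv ι f M) := hf.contGateaux_multiDeriv M hM
    refine tendsto_slope_of_tendsto_lineDeriv le_rfl (v := fun _ => v₀) (y := fun t => ι (c t))
      (y₀ := ι c₀) (v₀ := v₀) tendsto_const_nhds ((ι.continuous.tendsto _).comp hc) ?_ ?_
    · filter_upwards [hV.mem_nhds hv₀] with w hw t using hg.lineDifferentiableAt le_rfl hw _
    · have h1 := hf.tendsto_multiDeriv_cons hV (κ := ℕ) ∅ (ξ := fun _ _ => 0) (ξ₀ := fun _ => 0)
        (by simp) (tendsto_fst (f := 𝓝 v₀) (g := 𝓝[≠] (0 : ℝ))) hv₀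
        (hc.comp tendsto_snd) M (by simpa using hM)
      simp only [Finset.empty_val, Multiset.map_zero, add_zero] at h1
      refine h1.congr' ?_
      filter_upwards [tendsto_fst.eventually (hV.mem_nhds hv₀)] with p hp
      exact hf.multiDeriv_cons hV hM _ hp
  | @insert q Q hq ih =>
    rw [Finset.card_insert_of_notMem hq] at hM
    have hηQ : ∀ q ∈ Q, Tendsto (fun t => η t q) (𝓝[≠] 0) (𝓝 (η₀ q)) :=
      fun q' hq' => hη q' (Finset.mem_insert_of_mem hq')
    have h1 := ih hηQ (ξ₀ q ::ₘ M) (by rw [Multiset.card_cons]; omega)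
    have h2 := hf.tendsto_multiDeriv_cons hV Q (ξ := fun t q => ξ₀ q + t • η t q) (ξ₀ := ξ₀)
      (fun q' hq' => by simpa using (h0.smul (hηQ q' hq')).const_add (ξ₀ q')) hv hv₀
      (hη q (Finset.mem_insert_self _ _)) M (by omega)
    have hsum : ∑ q' ∈ insert q Q,
        multiDeriv ι f (η₀ q' ::ₘ (M + ((insert q Q).erase q').val.map ξ₀)) v₀ =
        multiDeriv ι f (η₀ q ::ₘ (M + Q.val.map ξ₀)) v₀ +
        ∑ q' ∈ Q, multiDeriv ι f (η₀ q' ::ₘ (ξ₀ q ::ₘ M + (Q.erase q').val.map ξ₀)) v₀ := by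
      rw [Finset.sum_insert hq, Finset.erase_insert hq]
      congr 1
      refine Finset.sum_congr rfl fun q' hq' => ?_
      have hne' : q ≠ q' := fun h => hq (h ▸ hq')
      rw [Finset.erase_insert_of_ne hne', Finset.insert_val_of_notMem (by simp [hq]),
        Multiset.map_cons, Multiset.add_cons, Multiset.cons_add]
    rw [hsum]
    have h3 := h1.add h2
    simp only [Finset.insert_val_of_notMem hq, Multiset.map_cons, Multiset.add_cons,
      Multiset.cons_add] at h3 ⊢
    rw [add_assoc, add_comm (Finset.sum _ _)] at h3
    refine h3.congr' ?_
    filter_upwards [hvV, hne] with t ht ht0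
    -- split off the change of the increment `ξ_q`, in which the derivative is linear
    obtain ⟨T, hT⟩ := hf.exists_clm_multiDeriv hV
      (M := M + Q.val.map (fun q => ξ₀ q + t • η t q)) (by simp; omega) ht
    rw [← hT, ← hT, ← hT, map_add, map_smul, add_sub_right_comm, smul_add, inv_smul_smul₀ ht0]

end ContGateaux

/-! ### Sums over partitions of subsets -/

section PartialPartitions

variable {ι : Type*} [DecidableEq ι]

/-- The partitions of the subsets of `s` into non-empty blocks, each given by its set of blocks:
the families of non-empty, pairwise disjoint subsets of `s`. -/
def partialPartitions (s : Finset ι) : Finset (Finset (Finset ι)) :=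
  {𝒜 ∈ s.powerset.powerset | ∅ ∉ 𝒜 ∧ ∀ p ∈ 𝒜, ∀ q ∈ 𝒜, p ≠ q → Disjoint p q}

theorem mem_partialPartitions {s : Finset ι} {𝒜 : Finset (Finset ι)} :
    𝒜 ∈ partialPartitions s ↔
      (∀ p ∈ 𝒜, p ⊆ s) ∧ ∅ ∉ 𝒜 ∧ ∀ p ∈ 𝒜, ∀ q ∈ 𝒜, p ≠ q → Disjoint p q := by
  simp only [partialPartitions, Finset.mem_filter, Finset.mem_powerset, Finset.subset_iff]

theorem singleton_mem_partialPartitions {s : Finset ι} (hs : s.Nonempty) :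
    {s} ∈ partialPartitions s := by
  rw [mem_partialPartitions]
  refine ⟨by simp, ?_, by simp⟩
  rw [Finset.mem_singleton]
  exact hs.ne_empty.symm

/-- The only partition of a subset of `s` with `s` among its blocks is `{s}`. -/
theorem eq_singleton_of_mem_partialPartitions {s : Finset ι} {𝒜 : Finset (Finset ι)}
    (h𝒜 : 𝒜 ∈ partialPartitions s) (hs : s ∈ 𝒜) : 𝒜 = {s} := by
  obtain ⟨h1, h2, h3⟩ := mem_partialPartitions.1 h𝒜
  refine Finset.eq_singleton_iff_unique_mem.2 ⟨hs, fun p hp => ?_⟩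
  by_contra hne
  have h4 := (h3 p hp s hs hne).eq_bot_of_le (h1 p hp)
  exact h2 (by rwa [Finset.bot_eq_empty.symm, ← h4])

/-- A partition of a subset of `insert a s` comes from one of a subset of `s`: either `a` is not in
the subset, or `{a}` is a block, or `a` has been added to a block. -/
theorem sum_partialPartitions_insert {N : Type*} [AddCommMonoid N] {s : Finset ι} {a : ι}
    (ha : a ∉ s) (F : Finset (Finset ι) → N) :
    ∑ 𝒜 ∈ partialPartitions (insert a s), F 𝒜 = ∑ 𝒜 ∈ partialPartitions s,
      (F 𝒜 + F (insert {a} 𝒜) + ∑ p ∈ 𝒜, F (insert (insert a p) (𝒜.erase p))) := by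
  have h1 : ∀ 𝒜 ∈ partialPartitions s,
      F 𝒜 + F (insert {a} 𝒜) + ∑ p ∈ 𝒜, F (insert (insert a p) (𝒜.erase p)) =
      F 𝒜 + ∑ p ∈ insert ∅ 𝒜, F (insert (insert a p) (𝒜.erase p)) := by
    intro 𝒜 h𝒜
    have hemp := (mem_partialPartitions.1 h𝒜).2.1
    rw [Finset.sum_insert hemp, Finset.erase_eq_of_notMem hemp, insert_empty_eq, add_assoc]
  rw [Finset.sum_congr rfl h1, Finset.sum_add_distrib,
    ← Finset.sum_filter_add_sum_filter_not _ (fun 𝒜 => ∀ p ∈ 𝒜, a ∉ p)]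
  congr 1
  · refine Finset.sum_congr (Finset.ext fun 𝒜 => ?_) fun _ _ => rfl
    rw [Finset.mem_filter, mem_partialPartitions, mem_partialPartitions]
    constructor
    · rintro ⟨⟨h1, h2⟩, h3⟩
      exact ⟨fun p hp => (Finset.subset_insert_iff_of_notMem (h3 p hp)).1 (h1 p hp), h2⟩
    · rintro ⟨h1, h2⟩
      exact ⟨⟨fun p hp => (h1 p hp).trans (Finset.subset_insert _ _), h2⟩,
        fun p hp h => ha (h1 p hp h)⟩
  · rw [Finset.sum_sigma']
    symm
    refine Finset.sum_bij (fun x _ => insert (insert a x.2) (x.1.erase x.2)) ?_ ?_ ?_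
      fun _ _ => rfl
    · rintro ⟨𝒜, p⟩ hx
      obtain ⟨h𝒜, hp⟩ := Finset.mem_sigma.1 hx
      obtain ⟨h1, h2, h3⟩ := mem_partialPartitions.1 h𝒜
      simp only at hp ⊢
      have hps : p ⊆ s := by
        rcases Finset.mem_insert.1 hp with rfl | hp
        · exact Finset.empty_subset _
        · exact h1 p hp
      have hdis : ∀ q ∈ 𝒜.erase p, Disjoint (insert a p) q := by
        intro q hq
        obtain ⟨hqp, hq⟩ := Finset.mem_erase.1 hq
        refine Finset.disjoint_insert_left.2 ⟨fun h => ha (h1 q hq h), ?_⟩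
        rcases Finset.mem_insert.1 hp with rfl | hp
        · exact Finset.disjoint_empty_left _
        · exact h3 p hp q hq hqp.symm
      rw [Finset.mem_filter, mem_partialPartitions]
      refine ⟨⟨?_, ?_, ?_⟩, ?_⟩
      · intro q hq
        rcases Finset.mem_insert.1 hq with rfl | hq
        · exact Finset.insert_subset_insert _ hps
        · exact (h1 q (Finset.mem_of_mem_erase hq)).trans (Finset.subset_insert _ _)
      · intro h
        rcases Finset.mem_insert.1 h with h | h
        · exact Finset.insert_ne_empty _ _ h.symm
        · exact h2 (Finset.mem_of_mem_erase h)
      · intro q hq r hr hqr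
        rcases Finset.mem_insert.1 hq with rfl | hq <;> rcases Finset.mem_insert.1 hr with rfl | hr
        · exact absurd rfl hqr
        · exact hdis r hr
        · exact (hdis q hq).symm
        · exact h3 q (Finset.mem_of_mem_erase hq) r (Finset.mem_of_mem_erase hr) hqr
      · intro h
        exact h _ (Finset.mem_insert_self _ _) (Finset.mem_insert_self _ _)
    · rintro ⟨𝒜, p⟩ hx ⟨𝒜', p'⟩ hx' heq
      obtain ⟨h𝒜, hp⟩ := Finset.mem_sigma.1 hx
      obtain ⟨h𝒜', hp'⟩ := Finset.mem_sigma.1 hx'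
      obtain ⟨h1, h2, -⟩ := mem_partialPartitions.1 h𝒜
      obtain ⟨h1', h2', -⟩ := mem_partialPartitions.1 h𝒜'
      simp only at hp hp' heq
      have hap : a ∉ p := by
        rcases Finset.mem_insert.1 hp with rfl | hp
        · exact Finset.notMem_empty _
        · exact fun h => ha (h1 p hp h)
      have hap' : a ∉ p' := by
        rcases Finset.mem_insert.1 hp' with rfl | hp'
        · exact Finset.notMem_empty _
        · exact fun h => ha (h1' p' hp' h)
      have hpp : p = p' := by
        have h5 : insert a p ∈ insert (insert a p') (𝒜'.erase p') :=
          heq ▸ Finset.mem_insert_self _ _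
        rcases Finset.mem_insert.1 h5 with h5 | h5
        · rw [← Finset.erase_insert hap, h5, Finset.erase_insert hap']
        · exact absurd (h1' _ (Finset.mem_of_mem_erase h5) (Finset.mem_insert_self _ _)) ha
      subst hpp
      have h6 : insert a p ∉ 𝒜.erase p := fun h =>
        ha (h1 _ (Finset.mem_of_mem_erase h) (Finset.mem_insert_self _ _))
      have h6' : insert a p ∉ 𝒜'.erase p := fun h =>
        ha (h1' _ (Finset.mem_of_mem_erase h) (Finset.mem_insert_self _ _))
      have h7 : 𝒜.erase p = 𝒜'.erase p := by
        rw [← Finset.erase_insert h6, heq, Finset.erase_insert h6']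
      have h8 : 𝒜 = 𝒜' := by
        rcases eq_or_ne p ∅ with rfl | hne
        · rwa [Finset.erase_eq_of_notMem h2, Finset.erase_eq_of_notMem h2'] at h7
        · rw [← Finset.insert_erase (Finset.mem_of_mem_insert_of_ne hp hne), h7,
            Finset.insert_erase (Finset.mem_of_mem_insert_of_ne hp' hne)]
      rw [h8]
    · intro 𝒬 h𝒬
      obtain ⟨h𝒬, hex⟩ := Finset.mem_filter.1 h𝒬
      obtain ⟨h1, h2, h3⟩ := mem_partialPartitions.1 h𝒬
      push Not at hex
      obtain ⟨q, hq, haq⟩ := hex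
      have hqs : q.erase a ⊆ s := Finset.subset_insert_iff.1 (h1 q hq)
      have hsub : ∀ r ∈ 𝒬.erase q, r ⊆ s := by
        intro r hr
        obtain ⟨hrq, hr⟩ := Finset.mem_erase.1 hr
        refine (Finset.subset_insert_iff_of_notMem ?_).1 (h1 r hr)
        exact fun h => (Finset.disjoint_left.1 (h3 r hr q hq hrq)) h haq
      have hdis : ∀ r ∈ 𝒬.erase q, Disjoint (q.erase a) r := by
        intro r hr
        obtain ⟨hrq, hr⟩ := Finset.mem_erase.1 hr
        exact (h3 q hq r hr hrq.symm).mono_left (Finset.erase_subset _ _)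
      have hnot : q.erase a ∉ 𝒬.erase q := by
        intro h
        have h5 := Finset.disjoint_self_iff_empty _ |>.1 (hdis _ h)
        exact h2 (h5 ▸ Finset.mem_of_mem_erase h)
      have hemp : ∅ ∉ 𝒬.erase q := fun h => h2 (Finset.mem_of_mem_erase h)
      have hex : ∃ 𝒜 ∈ partialPartitions s, q.erase a ∈ insert ∅ 𝒜 ∧
          𝒜.erase (q.erase a) = 𝒬.erase q := by
        rcases eq_or_ne (q.erase a) ∅ with h0 | h0
        · refine ⟨𝒬.erase q, mem_partialPartitions.2 ⟨hsub, hemp, fun p hp r hr =>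
            h3 p (Finset.mem_of_mem_erase hp) r (Finset.mem_of_mem_erase hr)⟩, ?_, ?_⟩
          · rw [h0]; exact Finset.mem_insert_self _ _
          · rw [h0, Finset.erase_eq_of_notMem hemp]
        · refine ⟨insert (q.erase a) (𝒬.erase q), mem_partialPartitions.2 ⟨?_, ?_, ?_⟩, ?_, ?_⟩
          · intro p hp
            rcases Finset.mem_insert.1 hp with rfl | hp
            · exact hqs
            · exact hsub p hp
          · intro h
            rcases Finset.mem_insert.1 h with h | h
            · exact h0 h.symm
            · exact hemp h
          · intro p hp r hr hpr
            rcases Finset.mem_insert.1 hp with rfl | hp <;>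
              rcases Finset.mem_insert.1 hr with rfl | hr
            · exact absurd rfl hpr
            · exact hdis r hr
            · exact (hdis p hp).symm
            · exact h3 p (Finset.mem_of_mem_erase hp) r (Finset.mem_of_mem_erase hr) hpr
          · exact Finset.mem_insert_of_mem (Finset.mem_insert_self _ _)
          · exact Finset.erase_insert hnot
      obtain ⟨𝒜, h𝒜, hp, he⟩ := hex
      refine ⟨⟨𝒜, q.erase a⟩, Finset.mem_sigma.2 ⟨h𝒜, hp⟩, ?_⟩
      simp only [he]
      rw [Finset.insert_erase haq, Finset.insert_erase hq]

/-- The recursion for partial partitions with the one-block partition of the whole set left out. -/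
theorem sum_partialPartitions_insert_erase {N : Type*} [AddCommGroup N] {s : Finset ι} {a : ι}
    (ha : a ∉ s) (hs : s.Nonempty) (F : Finset (Finset ι) → N) :
    ∑ 𝒜 ∈ (partialPartitions (insert a s)).erase {insert a s}, F 𝒜 =
      F {s} + F {{a}, s} + ∑ 𝒜 ∈ (partialPartitions s).erase {s},
      (F 𝒜 + F (insert {a} 𝒜) + ∑ p ∈ 𝒜, F (insert (insert a p) (𝒜.erase p))) := by
  have h1 := Finset.sum_erase_add (partialPartitions (insert a s)) F
    (singleton_mem_partialPartitions (Finset.insert_nonempty a s))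
  have h2 := Finset.sum_erase_add (partialPartitions s)
    (fun 𝒜 => F 𝒜 + F (insert {a} 𝒜) + ∑ p ∈ 𝒜, F (insert (insert a p) (𝒜.erase p)))
    (singleton_mem_partialPartitions hs)
  rw [sum_partialPartitions_insert ha, ← h2] at h1
  simp only [Finset.sum_singleton, Finset.erase_singleton, insert_empty_eq] at h1
  rw [← add_assoc, add_right_cancel_iff] at h1
  rw [h1, add_comm]

/-- Families of blocks versus pairs of a subset and a partition of it: the partitions with at least
`2 + |s| - j` blocks are those different from the one-block partition of the whole set. -/
theorem sum_partialPartitions_univ {N : Type*} [AddCommMonoid N] {j : ℕ} (hj : 1 ≤ j)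
    (F : Finset (Finset (Fin j)) → N) :
    ∑ 𝒜 ∈ (partialPartitions (Finset.univ : Finset (Fin j))).erase {Finset.univ}, F 𝒜 =
      F ∅ + ∑ s : Finset (Fin j) with s.Nonempty,
        ∑ i ∈ Finset.Icc (max 1 (2 + s.card - j)) s.card,
          ∑ P : Finpartition s with P.parts.card = i, F P.parts := by
  have : Nonempty (Fin j) := ⟨⟨0, hj⟩⟩
  have hmem : ∅ ∈ (partialPartitions (Finset.univ : Finset (Fin j))).erase {Finset.univ} := by
    rw [Finset.mem_erase, mem_partialPartitions]
    exact ⟨(Finset.singleton_ne_empty _).symm, by simp⟩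
  rw [← Finset.add_sum_erase _ F hmem]
  congr 1
  simp only [Finset.sum_fiberwise_eq_sum_filter]
  rw [Finset.sum_sigma']
  symm
  refine Finset.sum_bij (fun x _ => x.2.parts) ?_ ?_ ?_ fun _ _ => rfl
  · rintro ⟨s, P⟩ hx
    simp only [Finset.mem_sigma, Finset.mem_filter, Finset.mem_univ, true_and,
      Finset.mem_Icc] at hx
    obtain ⟨hs, h1, h2⟩ := hx
    have h3 := le_of_max_le_left h1
    have h4 := le_of_max_le_right h1
    refine Finset.mem_erase.2 ⟨?_, Finset.mem_erase.2 ⟨?_, mem_partialPartitions.2 ⟨by simp,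
      P.bot_notMem, fun p hp q hq hpq => P.disjoint hp hq hpq⟩⟩⟩
    · intro h
      simp only at h
      simp [h] at h3
    · intro h
      simp only at h
      have h5 : s = Finset.univ := by rw [← P.sup_parts, h, Finset.sup_singleton]; rfl
      rw [h, Finset.card_singleton, h5, Finset.card_univ, Fintype.card_fin] at h4
      omega
  · rintro ⟨s, P⟩ - ⟨s', P'⟩ - h
    simp only at h
    have h5 : s = s' := by rw [← P.sup_parts, ← P'.sup_parts, h]
    subst h5
    rw [Finpartition.ext h]
  · intro 𝒜 h𝒜
    obtain ⟨hne, h𝒜⟩ := Finset.mem_erase.1 h𝒜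
    obtain ⟨hne', h𝒜⟩ := Finset.mem_erase.1 h𝒜
    obtain ⟨h1, h2, h3⟩ := mem_partialPartitions.1 h𝒜
    let P : Finpartition (𝒜.sup id) :=
      { parts := 𝒜
        supIndep := Finset.supIndep_iff_pairwiseDisjoint.2 fun p hp q hq hpq => h3 p hp q hq hpq
        sup_parts := rfl
        bot_notMem := h2 }
    have hcard : 1 ≤ 𝒜.card := Finset.card_pos.2 (Finset.nonempty_iff_ne_empty.2 hne)
    have hle : 𝒜.card ≤ (𝒜.sup id).card := P.card_parts_le_card
    refine ⟨⟨𝒜.sup id, P⟩, ?_, rfl⟩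
    simp only [Finset.mem_sigma, Finset.mem_filter, Finset.mem_univ, true_and,
      Finset.mem_Icc]
    refine ⟨Finset.card_pos.1 (hcard.trans hle), max_le hcard ?_, hle⟩
    by_contra hlt
    have hlt : 𝒜.card < 2 + (𝒜.sup id).card - j := not_le.1 hlt
    have hsj : (𝒜.sup id).card ≤ j := (Finset.card_le_univ _).trans_eq (Fintype.card_fin j)
    obtain ⟨q, hq⟩ := Finset.card_eq_one.1 (show 𝒜.card = 1 by omega)
    refine hne' ?_
    have h4 : (𝒜.sup id) = Finset.univ := Finset.eq_univ_of_card _ (by rw [Fintype.card_fin]; omega)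
    rw [hq, Finset.sup_singleton] at h4
    rw [hq]
    exact congrArg _ h4

end PartialPartitions

/-! ### Differentiating fixed-point equations -/

theorem continuousOn_fixedPoint {X Y : Type*} [TopologicalSpace X] [NormedAddCommGroup Y] {U : Set X}
    {h : X × Y → Y} {α : ℝ} {φ : X → Y} (hα : α < 1)
    (hh : ∀ u ∈ U, ∀ y y', ‖h (u, y) - h (u, y')‖ ≤ α * ‖y - y'‖)
    (hc : ContinuousOn h (U ×ˢ univ)) (hφ : ∀ u ∈ U, h (u, φ u) = φ u) : ContinuousOn φ U := by
  intro u hu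
  have hpos : 0 < 1 - α := by linarith
  have h0 : ContinuousOn (fun u' => h (u', φ u)) U :=
    hc.comp (f := fun u' => (u', φ u)) (by fun_prop) fun u' hu' => ⟨hu', trivial⟩
  have h1 : Tendsto (fun u' => (1 - α)⁻¹ * ‖h (u', φ u) - h (u, φ u)‖) (𝓝[U] u) (𝓝 0) := by
    simpa using (tendsto_iff_norm_sub_tendsto_zero.1 (h0 u hu)).const_mul (1 - α)⁻¹
  refine tendsto_iff_norm_sub_tendsto_zero.2
    (squeeze_zero' (Eventually.of_forall fun _ => norm_nonneg _) ?_ h1)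
  filter_upwards [self_mem_nhdsWithin] with u' hu'
  rw [inv_mul_eq_div, le_div_iff₀ hpos]
  have h2 := hh u' hu' (φ u') (φ u)
  have h3 := norm_sub_le_norm_sub_add_norm_sub (h (u', φ u')) (h (u', φ u)) (h (u, φ u))
  rw [hφ u' hu', hφ u hu] at *
  linarith

section FixedPoint

variable {X Y : Type*} [NormedAddCommGroup X] [NormedSpace ℝ X]
  [NormedAddCommGroup Y] [NormedSpace ℝ Y]

/-- If `e t` predicts the increment `δ t` up to a contraction of the error `δ t - t z`, and `e t / t`
tends to `z`, then so does `δ t / t`. -/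
theorem tendsto_inv_smul_of_contraction {α : ℝ} (hα : α < 1) {δ e : ℝ → Y} {z : Y}
    (hδ : ∀ᶠ t in 𝓝[≠] 0, ‖δ t - e t‖ ≤ α * ‖δ t - t • z‖)
    (he : Tendsto (fun t => t⁻¹ • e t) (𝓝[≠] 0) (𝓝 z)) :
    Tendsto (fun t => t⁻¹ • δ t) (𝓝[≠] 0) (𝓝 z) := by
  rw [tendsto_iff_norm_sub_tendsto_zero] at he ⊢
  have hpos : 0 < 1 - α := by linarith
  have h1 : Tendsto (fun t => (1 - α)⁻¹ * ‖t⁻¹ • e t - z‖) (𝓝[≠] 0) (𝓝 0) := by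
    simpa using he.const_mul (1 - α)⁻¹
  refine squeeze_zero' (Eventually.of_forall fun _ => norm_nonneg _) ?_ h1
  filter_upwards [hδ, self_mem_nhdsWithin] with t ht ht0
  have hscale : ∀ y : Y, ‖t⁻¹ • y - z‖ = |t|⁻¹ * ‖y - t • z‖ := fun y => by
    rw [← Real.norm_eq_abs, ← norm_inv, ← norm_smul, smul_sub, inv_smul_smul₀ ht0]
  rw [hscale, hscale, ← mul_assoc, mul_comm (1 - α)⁻¹, mul_assoc]
  refine mul_le_mul_of_nonneg_left ?_ (by positivity)
  rw [inv_mul_eq_div, le_div_iff₀ hpos]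
  have h2 : ‖δ t - t • z‖ ≤ ‖δ t - e t‖ + ‖e t - t • z‖ := norm_sub_le_norm_sub_add_norm_sub _ _ _
  linarith

/-- Solutions of `w = A w + R` with `‖A‖ ≤ α < 1` depend continuously on strongly continuous `A` and
continuous `R`. -/
theorem continuousOn_of_eq_clm_apply_add {P : Type*} [TopologicalSpace P] {α : ℝ} (hα : α < 1)
    {U : Set P} {A : P → Y →L[ℝ] Y} {w R : P → Y} (hA : ∀ u ∈ U, ‖A u‖ ≤ α)
    (hAc : ∀ y, ContinuousOn (fun u => A u y) U) (hR : ContinuousOn R U)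
    (hw : ∀ u ∈ U, w u = A u (w u) + R u) : ContinuousOn w U := by
  intro u hu
  have hpos : 0 < 1 - α := by linarith
  have h1 : Tendsto (fun u' => (1 - α)⁻¹ * (‖A u' (w u) - A u (w u)‖ + ‖R u' - R u‖)) (𝓝[U] u)
      (𝓝 0) := by
    simpa using ((tendsto_iff_norm_sub_tendsto_zero.1 (hAc (w u) u hu)).add
      (tendsto_iff_norm_sub_tendsto_zero.1 (hR u hu))).const_mul (1 - α)⁻¹
  refine tendsto_iff_norm_sub_tendsto_zero.2
    (squeeze_zero' (Eventually.of_forall fun _ => norm_nonneg _) ?_ h1)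
  filter_upwards [self_mem_nhdsWithin] with u' hu'
  rw [inv_mul_eq_div, le_div_iff₀ hpos]
  have h2 : w u' - w u = A u' (w u' - w u) + (A u' (w u) - A u (w u)) + (R u' - R u) := by
    rw [map_sub]
    nth_rewrite 1 [hw u' hu', hw u hu]
    abel
  have h3 : ‖w u' - w u‖ ≤ α * ‖w u' - w u‖ + ‖A u' (w u) - A u (w u)‖ + ‖R u' - R u‖ := by
    nth_rewrite 1 [h2]
    exact norm_add₃_le.trans (by gcongr; exact (A u').le_of_opNorm_le (hA u' hu') _)
  linarith

theorem isUnit_one_sub_of_norm_le [CompleteSpace Y] {α : ℝ} (hα : α < 1) {A : Y →L[ℝ] Y}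
    (hA : ‖A‖ ≤ α) : IsUnit (1 - A) := isUnit_one_sub_of_norm_lt_one (hA.trans_lt hα)

theorem eq_clm_apply_add_iff {A : Y →L[ℝ] Y} (hA : IsUnit (1 - A)) {z r : Y} :
    z = A z + r ↔ z = Ring.inverse (1 - A) r := by
  have h1 : ∀ y, Ring.inverse (1 - A) ((1 - A) y) = y := fun y =>
    DFunLike.congr_fun (Ring.inverse_mul_cancel _ hA) y
  have h2 : ∀ y, (1 - A) (Ring.inverse (1 - A) y) = y := fun y =>
    DFunLike.congr_fun (Ring.mul_inverse_cancel _ hA) y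
  have h3 : (1 - A) z = z - A z := rfl
  constructor
  · intro h
    rw [← h1 z, h3, sub_eq_of_eq_add' h]
  · intro h
    have h4 := h2 r
    rw [← h, h3] at h4
    rw [← h4]
    abel

variable {U : Set X} {h : X × Y → Y} {α : ℝ} {A : X × Y → Y →L[ℝ] Y} {φ : X → Y}

/-- The partial Gâteaux differential `∂_Y h` of a contraction, as a bounded operator of norm at most
the contraction constant. -/
theorem exists_clm_deriv_of_contraction [CompleteSpace Y] (hU : IsOpen U)
    (hα0 : 0 ≤ α) (hh : ∀ u ∈ U, ∀ y y', ‖h (u, y) - h (u, y')‖ ≤ α * ‖y - y'‖)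
    (hd : ContGateaux 1 (ContinuousLinearMap.inr ℝ X Y) (U ×ˢ univ) h) :
    ∃ A : X × Y → Y →L[ℝ] Y, (∀ v ∈ U ×ˢ univ, ∀ w, HasLineDerivAt ℝ h (A v w) v (0, w)) ∧
      (∀ v ∈ U ×ˢ univ, ‖A v‖ ≤ α) ∧ ∀ w, ContinuousOn (fun v => A v w) (U ×ˢ univ) := by
  have hV : IsOpen (U ×ˢ (univ : Set Y)) := hU.prod isOpen_univ
  choose! A hA using fun v (hv : v ∈ U ×ˢ (univ : Set Y)) => hd.exists_clm hV le_rfl hv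
  have hA' : ∀ v ∈ U ×ˢ univ, ∀ w, HasLineDerivAt ℝ h (A v w) v (0, w) := by
    intro v hv w
    rw [hA v hv]
    exact (hd.lineDifferentiableAt le_rfl hv w).hasLineDerivAt
  refine ⟨A, hA', fun v hv => ?_, fun w => (hd.continuousOn_lineDeriv le_rfl w).congr
    fun v hv => hA v hv w⟩
  refine ContinuousLinearMap.opNorm_le_bound _ hα0 fun w => ?_
  refine le_of_tendsto (hA' v hv w).tendsto_slope_zero.norm ?_
  filter_upwards [self_mem_nhdsWithin] with t ht
  have h1 : v + t • ((0 : X), w) = (v.1, v.2 + t • w) := by ext <;> simp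
  have h2 : ‖h (v + t • ((0 : X), w)) - h v‖ ≤ α * ‖t • w‖ := by
    rw [h1]
    simpa using hh v.1 hv.1 (v.2 + t • w) v.2
  rw [norm_smul, norm_inv]
  rw [norm_smul] at h2
  have h3 : 0 < ‖t‖ := norm_pos_iff.2 ht
  calc ‖t‖⁻¹ * _ ≤ ‖t‖⁻¹ * (α * (‖t‖ * ‖w‖)) := by gcongr
    _ = α * ‖w‖ := by field_simp

theorem hasLineDerivAt_fixedPoint (hU : IsOpen U) (hα : α < 1)
    (hh : ∀ u ∈ U, ∀ y y', ‖h (u, y) - h (u, y')‖ ≤ α * ‖y - y'‖)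
    (hA : ∀ v ∈ U ×ˢ univ, ∀ w, HasLineDerivAt ℝ h (A v w) v (0, w))
    (hAc : ∀ w, ContinuousOn (fun v => A v w) (U ×ˢ univ))
    (hφ : ∀ u ∈ U, h (u, φ u) = φ u) {u : X} (hu : u ∈ U) {x : X} {z r : Y}
    (hr : HasLineDerivAt ℝ h r (u, φ u) (x, 0)) (hz : z = A (u, φ u) z + r) :
    HasLineDerivAt ℝ φ z u x := by
  have hV : IsOpen (U ×ˢ (univ : Set Y)) := hU.prod isOpen_univ
  rw [hasLineDerivAt_iff_tendsto_slope_zero]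
  refine tendsto_inv_smul_of_contraction hα
    (e := fun t => h (u + t • x, φ u + t • z) - h (u, φ u)) ?_ ?_
  · filter_upwards [(tendsto_add_smul_nhdsNE u x).eventually (hU.mem_nhds hu)] with t ht
    have h1 := hh _ ht (φ (u + t • x)) (φ u + t • z)
    rw [hφ _ ht] at h1
    rw [hφ u hu]
    rw [← sub_sub] at h1
    simpa using h1
  · have hl : ∀ w ∈ U ×ˢ (univ : Set Y), lineDeriv ℝ h w (0, z) = A w z := fun w hw =>
      (hA w hw z).lineDeriv
    have h1 := HasLineDerivAt.add_of_continuousOn hV (⟨hu, trivial⟩ : (u, φ u) ∈ U ×ˢ univ) hr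
      (fun w hw => (hA w hw z).lineDifferentiableAt) ((hAc z).congr hl)
    rw [hl _ ⟨hu, trivial⟩, add_comm r, ← hz] at h1
    refine h1.tendsto_slope_zero.congr fun t => ?_
    simp

/-- The fixed-point map of a uniform contraction which is once continuously Gâteaux differentiable
is once continuously Gâteaux differentiable. -/
theorem contGateaux_one_fixedPoint [CompleteSpace Y] (hU : IsOpen U) (hα : α < 1)
    (hh : ∀ u ∈ U, ∀ y y', ‖h (u, y) - h (u, y')‖ ≤ α * ‖y - y'‖)
    (hA : ∀ v ∈ U ×ˢ univ, ∀ w, HasLineDerivAt ℝ h (A v w) v (0, w))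
    (hAα : ∀ v ∈ U ×ˢ univ, ‖A v‖ ≤ α)
    (hAc : ∀ w, ContinuousOn (fun v => A v w) (U ×ˢ univ))
    (hd : ContGateaux 1 (ContinuousLinearMap.inl ℝ X Y) (U ×ˢ univ) h)
    (hφ : ∀ u ∈ U, h (u, φ u) = φ u) :
    ContGateaux 1 (ContinuousLinearMap.id ℝ X) U φ ∧ ∀ u ∈ U, ∀ x,
      lineDeriv ℝ φ u x = A (u, φ u) (lineDeriv ℝ φ u x) + lineDeriv ℝ h (u, φ u) (x, 0) := by
  have hφc := continuousOn_fixedPoint hα hh hd.continuousOn hφ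
  have hmem : ∀ u ∈ U, (u, φ u) ∈ U ×ˢ (univ : Set Y) := fun u hu => ⟨hu, trivial⟩
  have hgc : ContinuousOn (fun u => (u, φ u)) U := continuousOn_id.prodMk hφc
  have key : ∀ u ∈ U, ∀ x, ∃ z, HasLineDerivAt ℝ φ z u x ∧
      z = A (u, φ u) z + lineDeriv ℝ h (u, φ u) (x, 0) := by
    intro u hu x
    have hz := (eq_clm_apply_add_iff (isUnit_one_sub_of_norm_le hα (hAα _ (hmem u hu)))
      (r := lineDeriv ℝ h (u, φ u) (x, 0))).2 rfl
    exact ⟨_, hasLineDerivAt_fixedPoint hU hα hh hA hAc hφ hu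
      (hd.lineDifferentiableAt le_rfl (hmem u hu) x).hasLineDerivAt hz, hz⟩
  have heq : ∀ u ∈ U, ∀ x,
      lineDeriv ℝ φ u x = A (u, φ u) (lineDeriv ℝ φ u x) + lineDeriv ℝ h (u, φ u) (x, 0) := by
    intro u hu x
    obtain ⟨z, hz, hz'⟩ := key u hu x
    rwa [hz.lineDeriv]
  refine ⟨fun L hL => ?_, heq⟩
  rcases L with _ | ⟨x, _ | ⟨y, l⟩⟩
  · exact ⟨trivial, hφc⟩
  · refine ⟨⟨fun u hu => ?_, trivial⟩, ?_⟩
    · obtain ⟨z, hz, -⟩ := key u hu x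
      exact hz.lineDifferentiableAt
    · exact continuousOn_of_eq_clm_apply_add hα (fun u hu => hAα _ (hmem u hu))
        (fun y => (hAc y).comp hgc hmem) ((hd.continuousOn_lineDeriv le_rfl x).comp hgc hmem)
        (fun u hu => heq u hu x)
  · simp at hL

end FixedPoint

/-! ### Raising the order of differentiability along an embedding -/

section SetDeriv

variable {κ : Type*} [LinearOrder κ] {X F : Type*} [NormedAddCommGroup X] [NormedSpace ℝ X]
  [NormedAddCommGroup F] [NormedSpace ℝ F]

/-- The iterated derivative `∂_s f` in the directions `x a`, `a ∈ s`, taken in increasing order. -/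
noncomputable def setDeriv (x : κ → X) (f : X → F) (s : Finset κ) : X → F :=
  iterDirDeriv f ((s.sort (· ≤ ·)).map x)

theorem sort_insert_of_forall_lt {s : Finset κ} {a : κ} (ha : ∀ b ∈ s, b < a) :
    (insert a s).sort (· ≤ ·) = s.sort (· ≤ ·) ++ [a] := by
  have hnot : a ∉ s := fun h => lt_irrefl a (ha a h)
  refine List.Perm.eq_of_pairwise' (r := (· ≤ ·)) (Finset.pairwise_sort _ _) ?_ ?_
  · rw [List.pairwise_append]
    refine ⟨Finset.pairwise_sort _ _, List.pairwise_singleton _ _, fun b hb c hc => ?_⟩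
    rw [List.mem_singleton.1 hc]
    exact (ha b ((Finset.mem_sort _).1 hb)).le
  · refine (List.perm_ext_iff_of_nodup (Finset.sort_nodup _ _) ?_).2 fun b => ?_
    · rw [List.nodup_append_comm]
      simpa [Finset.sort_nodup] using hnot
    · simp [or_comm]

theorem setDeriv_insert (x : κ → X) (f : X → F) {s : Finset κ} {a : κ} (ha : ∀ b ∈ s, b < a) :
    setDeriv x f (insert a s) = fun u => lineDeriv ℝ (setDeriv x f s) u (x a) := by
  rw [setDeriv, sort_insert_of_forall_lt ha, List.map_append, iterDirDeriv_append]
  rfl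

theorem ContGateaux.dirDerivExistsOn_of_length_le {n : ℕ} {U : Set X} {f : X → F}
    (hf : ContGateaux n (ContinuousLinearMap.id ℝ X) U f) {L : List X} (hL : L.length ≤ n) :
    DirDerivExistsOn U f L ∧ ContinuousOn (iterDirDeriv f L) U := by
  simpa using hf L hL

theorem ContGateaux.setDeriv_of_card_le {n m : ℕ} {U : Set X} {f : X → F}
    (hf : ContGateaux n (ContinuousLinearMap.id ℝ X) U f) (x : κ → X) {s : Finset κ}
    (hs : s.card + m ≤ n) : ContGateaux m (ContinuousLinearMap.id ℝ X) U (setDeriv x f s) := by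
  have := hf.iterate (m := m) ((s.sort (· ≤ ·)).map x) (by simpa using hs)
  simpa [setDeriv] using this

end SetDeriv

section BlockMultiset

variable {κ X Z : Type*} [DecidableEq κ] [Zero X] [Zero Z]

/-- The increments of `∂_{s \ ⋃ 𝒜} ∂_{W p, p ∈ 𝒜}`: the vectors `(x a, 0)` for the `a ∈ s` in no block,
and `(0, W p)` for the blocks `p ∈ 𝒜`. -/
def blockMultiset (x : κ → X) (W : Finset κ → Z) (s : Finset κ) (𝒜 : Finset (Finset κ)) :
    Multiset (X × Z) :=
  (s \ 𝒜.sup id).val.map (fun a => (x a, 0)) + 𝒜.val.map (fun p => (0, W p))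

theorem card_le_card_sup {s : Finset κ} {𝒜 : Finset (Finset κ)} (h𝒜 : 𝒜 ∈ partialPartitions s) :
    𝒜.card ≤ (𝒜.sup id).card := by
  obtain ⟨-, h2, h3⟩ := mem_partialPartitions.1 h𝒜
  exact Finpartition.card_parts_le_card
    { parts := 𝒜
      supIndep := Finset.supIndep_iff_pairwiseDisjoint.2 fun p hp q hq hpq => h3 p hp q hq hpq
      sup_parts := rfl
      bot_notMem := h2 }

theorem sup_subset_of_mem {s : Finset κ} {𝒜 : Finset (Finset κ)} (h𝒜 : 𝒜 ∈ partialPartitions s) :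
    𝒜.sup id ⊆ s := Finset.sup_le (mem_partialPartitions.1 h𝒜).1

theorem card_sdiff_add_card_le {s : Finset κ} {𝒜 : Finset (Finset κ)}
    (h𝒜 : 𝒜 ∈ partialPartitions s) : (s \ 𝒜.sup id).card + 𝒜.card ≤ s.card := by
  rw [Finset.card_sdiff_of_subset (sup_subset_of_mem h𝒜)]
  have := card_le_card_sup h𝒜
  have := Finset.card_le_card (sup_subset_of_mem h𝒜)
  omega

variable (x : κ → X) (W : Finset κ → Z) {s : Finset κ} {𝒜 : Finset (Finset κ)} {a : κ}

theorem blockMultiset_insert (ha : a ∉ s) (h𝒜 : 𝒜 ∈ partialPartitions s) :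
    blockMultiset x W (insert a s) 𝒜 = (x a, 0) ::ₘ blockMultiset x W s 𝒜 := by
  have h1 : a ∉ 𝒜.sup id := fun h => ha (sup_subset_of_mem h𝒜 h)
  have h2 : a ∉ s \ 𝒜.sup id := fun h => ha (Finset.mem_sdiff.1 h).1
  rw [blockMultiset, blockMultiset, Finset.insert_sdiff_of_notMem _ h1,
    Finset.insert_val_of_notMem h2, Multiset.map_cons, Multiset.cons_add]

theorem blockMultiset_insert_singleton (ha : a ∉ s) (h𝒜 : 𝒜 ∈ partialPartitions s) :
    blockMultiset x W (insert a s) (insert {a} 𝒜) = (0, W {a}) ::ₘ blockMultiset x W s 𝒜 := by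
  have h1 : {a} ∉ 𝒜 := fun h =>
    ha ((mem_partialPartitions.1 h𝒜).1 _ h (Finset.mem_singleton_self a))
  have h2 : insert a s \ (insert {a} 𝒜).sup id = s \ 𝒜.sup id := by
    rw [Finset.sup_insert, id, Finset.sup_eq_union, ← Finset.insert_eq]
    ext b
    simp only [Finset.mem_sdiff, Finset.mem_insert]
    grind
  rw [blockMultiset, blockMultiset, h2, Finset.insert_val_of_notMem h1, Multiset.map_cons,
    Multiset.add_cons]

theorem blockMultiset_insert_insert (ha : a ∉ s) (h𝒜 : 𝒜 ∈ partialPartitions s) {p : Finset κ}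
    (hp : p ∈ 𝒜) :
    blockMultiset x W (insert a s) (insert (insert a p) (𝒜.erase p)) =
      (0, W (insert a p)) ::ₘ ((s \ 𝒜.sup id).val.map (fun a => (x a, 0)) +
        (𝒜.erase p).val.map (fun p => (0, W p))) := by
  have h1 : insert a p ∉ 𝒜.erase p := fun h =>
    ha ((mem_partialPartitions.1 h𝒜).1 _ (Finset.mem_of_mem_erase h) (Finset.mem_insert_self _ _))
  have h2 : insert a s \ (insert (insert a p) (𝒜.erase p)).sup id = s \ 𝒜.sup id := by
    have h3 : 𝒜.sup id = p ∪ (𝒜.erase p).sup id := by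
      conv_lhs => rw [← Finset.insert_erase hp, Finset.sup_insert]
      rfl
    rw [h3, Finset.sup_insert, id, Finset.sup_eq_union]
    ext b
    simp only [Finset.mem_sdiff, Finset.mem_insert, Finset.mem_union]
    grind
  rw [blockMultiset, h2, Finset.insert_val_of_notMem h1, Multiset.map_cons,
    Multiset.add_cons]

end BlockMultiset

section OrderGain

variable {X Y Z : Type*} [NormedAddCommGroup X] [NormedSpace ℝ X] [CompleteSpace X]
  [NormedAddCommGroup Y] [NormedSpace ℝ Y]
  [NormedAddCommGroup Z] [NormedSpace ℝ Z] [CompleteSpace Z]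
  {n j : ℕ} {U : Set X} {h : X × Y → Y} {α : ℝ} {A : X × Y → Y →L[ℝ] Y} {φ : X → Y} {φZ : X → Z}
  {e : Z →L[ℝ] Y} {κ : Type*} [LinearOrder κ]

/-- The derivative `∂_{s \ ⋃ 𝒜} ∂_{∂_p φ(u), p ∈ 𝒜} h (u, φ(u))`, with the increments `∂_p φ(u)` taken in
the smaller space `Z` in which `φ` is the map `φZ`. -/
noncomputable def blockDeriv (e : Z →L[ℝ] Y) (h : X × Y → Y) (φ : X → Y) (φZ : X → Z) (x : κ → X)
    (s : Finset κ) (𝒜 : Finset (Finset κ)) (u : X) : Y :=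
  multiDeriv ((ContinuousLinearMap.id ℝ X).prodMap e) h
    (blockMultiset x (fun p => setDeriv x φZ p u) s 𝒜) (u, φ u)

/-- Product and chain rule for the derivatives of `h` along the graph of `φ`, with fixed increments
`M` and moving increments `W q`. -/
theorem hasLineDerivAt_multiDeriv_graph (hU : IsOpen U)
    (hd : ContGateaux n ((ContinuousLinearMap.id ℝ X).prodMap e) (U ×ˢ univ) h)
    (he : ∀ u ∈ U, e (φZ u) = φ u) {u ξ : X} (hu : u ∈ U) (hφ : LineDifferentiableAt ℝ φZ u ξ)
    {ι : Type*} [DecidableEq ι] {Q : Finset ι} {W : ι → X → Z}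
    (hW : ∀ q ∈ Q, LineDifferentiableAt ℝ (W q) u ξ) {M : Multiset (X × Z)}
    (hM : M.card + Q.card + 1 ≤ n) :
    HasLineDerivAt ℝ
      (fun u' => multiDeriv ((ContinuousLinearMap.id ℝ X).prodMap e) h
        (M + Q.val.map fun q => (0, W q u')) (u', φ u'))
      (multiDeriv ((ContinuousLinearMap.id ℝ X).prodMap e) h
          ((ξ, 0) ::ₘ (M + Q.val.map fun q => (0, W q u))) (u, φ u) +
        multiDeriv ((ContinuousLinearMap.id ℝ X).prodMap e) h
          ((0, lineDeriv ℝ φZ u ξ) ::ₘ (M + Q.val.map fun q => (0, W q u))) (u, φ u) +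
        ∑ q ∈ Q, multiDeriv ((ContinuousLinearMap.id ℝ X).prodMap e) h
          ((0, lineDeriv ℝ (W q) u ξ) ::ₘ (M + (Q.erase q).val.map fun q => (0, W q u)))
          (u, φ u)) u ξ := by
  have hV : IsOpen (U ×ˢ (univ : Set Y)) := hU.prod isOpen_univ
  have hv₀ : (u, φ u) ∈ U ×ˢ (univ : Set Y) := ⟨hu, trivial⟩
  have hc : Tendsto (fun t : ℝ => (ξ, t⁻¹ • (φZ (u + t • ξ) - φZ u))) (𝓝[≠] 0)
      (𝓝 (ξ, lineDeriv ℝ φZ u ξ)) :=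
    tendsto_const_nhds.prodMk_nhds hφ.hasLineDerivAt.tendsto_slope_zero
  have h1 := hd.tendsto_slope_multiDeriv hV hv₀ hc (fun q => ((0 : X), W q u)) Q
    (η := fun t q => (0, t⁻¹ • (W q (u + t • ξ) - W q u)))
    (η₀ := fun q => (0, lineDeriv ℝ (W q) u ξ))
    (fun q hq => tendsto_const_nhds.prodMk_nhds (hW q hq).hasLineDerivAt.tendsto_slope_zero) M hM
  obtain ⟨T, hT⟩ := hd.exists_clm_multiDeriv hV
    (M := M + Q.val.map fun q => ((0 : X), W q u)) (by simpa using hM) hv₀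
  have h2 : (ξ, lineDeriv ℝ φZ u ξ) = (ξ, (0 : Z)) + ((0 : X), lineDeriv ℝ φZ u ξ) := by simp
  rw [← hT, h2, map_add, hT, hT] at h1
  rw [hasLineDerivAt_iff_tendsto_slope_zero]
  refine h1.congr' ?_
  filter_upwards [(tendsto_add_smul_nhdsNE u ξ).eventually (hU.mem_nhds hu),
    self_mem_nhdsWithin] with t ht ht0
  have h3 : (u, φ u) + t • ((ContinuousLinearMap.id ℝ X).prodMap e)
      (ξ, t⁻¹ • (φZ (u + t • ξ) - φZ u)) = (u + t • ξ, φ (u + t • ξ)) := by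
    ext
    · simp
    · have h5 : (((ContinuousLinearMap.id ℝ X).prodMap e)
          (ξ, t⁻¹ • (φZ (u + t • ξ) - φZ u))).2 = e (t⁻¹ • (φZ (u + t • ξ) - φZ u)) := rfl
      rw [Prod.snd_add, Prod.smul_snd, h5, map_smul, smul_inv_smul₀ ht0, map_sub, he _ ht, he u hu]
      abel
  have h4 : ∀ q, ((0 : X), W q u) + t • ((0 : X), t⁻¹ • (W q (u + t • ξ) - W q u)) =
      (0, W q (u + t • ξ)) := by
    intro q
    ext
    · simp
    · simp only [Prod.snd_add, Prod.smul_snd]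
      rw [smul_inv_smul₀ ht0]
      abel
  simp only [h3, h4]

/-- The derivative of a block derivative in a new direction `x a` consists of the block derivatives
for `insert a s` in which `a` is in no block, forms a block, or is added to one of the blocks. -/
theorem hasLineDerivAt_blockDeriv (hU : IsOpen U)
    (hd : ContGateaux n ((ContinuousLinearMap.id ℝ X).prodMap e) (U ×ˢ univ) h)
    (hZ : ContGateaux j (ContinuousLinearMap.id ℝ X) U φZ) (hj : 1 ≤ j)
    (he : ∀ u ∈ U, e (φZ u) = φ u) (x : κ → X) {s : Finset κ} {a : κ} (ha : ∀ b ∈ s, b < a)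
    (hs : s.card + 1 ≤ n) {𝒜 : Finset (Finset κ)} (h𝒜 : 𝒜 ∈ partialPartitions s)
    (hcard : ∀ p ∈ 𝒜, p.card < j) {u : X} (hu : u ∈ U) :
    HasLineDerivAt ℝ (blockDeriv e h φ φZ x s 𝒜)
      (blockDeriv e h φ φZ x (insert a s) 𝒜 u + blockDeriv e h φ φZ x (insert a s) (insert {a} 𝒜) u +
        ∑ p ∈ 𝒜, blockDeriv e h φ φZ x (insert a s) (insert (insert a p) (𝒜.erase p)) u) u (x a) := by
  have hnot : a ∉ s := fun h => lt_irrefl a (ha a h)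
  have hsub := (mem_partialPartitions.1 h𝒜).1
  have hle := card_sdiff_add_card_le h𝒜
  have h1 := hasLineDerivAt_multiDeriv_graph hU hd he hu (hZ.lineDifferentiableAt hj hu (x a))
    (Q := 𝒜) (W := fun p => setDeriv x φZ p)
    (M := (s \ 𝒜.sup id).val.map fun a => (x a, 0))
    (fun p hp => (hZ.setDeriv_of_card_le x (m := 1) (hcard p hp)).lineDifferentiableAt le_rfl hu (x a))
    (by rw [Multiset.card_map]; exact (Nat.succ_le_succ hle).trans hs)
  have h2 : setDeriv x φZ {a} = fun u => lineDeriv ℝ φZ u (x a) := by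
    rw [← insert_empty_eq, setDeriv_insert x φZ (by simp)]
    simp [setDeriv, iterDirDeriv]
  unfold blockDeriv
  rw [blockMultiset_insert _ _ hnot h𝒜, blockMultiset_insert_singleton _ _ hnot h𝒜, h2]
  rw [Finset.sum_congr rfl fun p hp => by rw [blockMultiset_insert_insert _ _ hnot h𝒜 hp,
    setDeriv_insert x φZ fun b hb => ha b (hsub p hp hb)]]
  exact h1

theorem continuousOn_blockDeriv (hU : IsOpen U)
    (hd : ContGateaux n ((ContinuousLinearMap.id ℝ X).prodMap e) (U ×ˢ univ) h)
    (hZ : ContGateaux j (ContinuousLinearMap.id ℝ X) U φZ) (hφ : ContinuousOn φ U)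
    (x : κ → X) {s : Finset κ} (hs : s.card ≤ n) {𝒜 : Finset (Finset κ)}
    (h𝒜 : 𝒜 ∈ partialPartitions s) (hcard : ∀ p ∈ 𝒜, p.card ≤ j) :
    ContinuousOn (blockDeriv e h φ φZ x s 𝒜) U := by
  intro u hu
  refine hd.tendsto_multiDeriv (hU.prod isOpen_univ) 𝒜
    (ξ := fun u p => (0, setDeriv x φZ p u)) (ξ₀ := fun p => (0, setDeriv x φZ p u))
    (fun p hp => ?_) (tendsto_id.mono_left nhdsWithin_le_nhds |>.prodMk_nhds (hφ u hu))
    ⟨hu, trivial⟩ _ (by rw [Multiset.card_map]; exact (card_sdiff_add_card_le h𝒜).trans hs)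
  exact tendsto_const_nhds.prodMk_nhds
    ((hZ.setDeriv_of_card_le x (m := 0) (hcard p hp)).continuousOn u hu)

theorem card_lt_of_mem_partialPartitions_erase {s : Finset κ} {𝒜 : Finset (Finset κ)}
    (h𝒜 : 𝒜 ∈ (partialPartitions s).erase {s}) {p : Finset κ} (hp : p ∈ 𝒜) : p.card < s.card := by
  obtain ⟨hne, h𝒜⟩ := Finset.mem_erase.1 h𝒜
  refine Finset.card_lt_card (((mem_partialPartitions.1 h𝒜).1 p hp).ssubset_of_ne ?_)
  rintro rfl
  exact hne (eq_singleton_of_mem_partialPartitions h𝒜 hp)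

/-- One order of differentiability is gained at the price of passing from `Z` to the larger space
`Y`. The derivatives `w = ∂_s φ` solve `w = A w + R` with `A = ∂_Y h (u, φ u)`, where `R` contains
derivatives of `φ` of lower order only; differentiating this equation raises the order. -/
theorem setDeriv_fixedPoint [CompleteSpace Y] (hU : IsOpen U) (hα : α < 1)
    (hA : ∀ v ∈ U ×ˢ univ, ∀ w, HasLineDerivAt ℝ h (A v w) v (0, w))
    (hAα : ∀ v ∈ U ×ˢ univ, ‖A v‖ ≤ α)
    (hAc : ∀ w, ContinuousOn (fun v => A v w) (U ×ˢ univ))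
    (hd : ContGateaux n ((ContinuousLinearMap.id ℝ X).prodMap e) (U ×ˢ univ) h)
    (hZ : ContGateaux j (ContinuousLinearMap.id ℝ X) U φZ) (hj : 1 ≤ j) (hjn : j + 1 ≤ n)
    (he : ∀ u ∈ U, e (φZ u) = φ u)
    (h1 : ∀ u ∈ U, ∀ x,
      lineDeriv ℝ φ u x = A (u, φ u) (lineDeriv ℝ φ u x) + lineDeriv ℝ h (u, φ u) (x, 0))
    (x : κ → X) (s : Finset κ) (hs : s.card ≤ j + 1) (hne : s.Nonempty) :
    DirDerivExistsOn U φ ((s.sort (· ≤ ·)).map x) ∧ ∀ u ∈ U,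
      setDeriv x φ s u = A (u, φ u) (setDeriv x φ s u) +
        ∑ 𝒜 ∈ (partialPartitions s).erase {s}, blockDeriv e h φ φZ x s 𝒜 u := by
  have hV : IsOpen (U ×ˢ (univ : Set Y)) := hU.prod isOpen_univ
  have hmem : ∀ u ∈ U, (u, φ u) ∈ U ×ˢ (univ : Set Y) := fun u hu => ⟨hu, trivial⟩
  have hφ : ContGateaux j (ContinuousLinearMap.id ℝ X) U φ := (hZ.clm_comp hU e).congr hU he
  have hφc := hφ.continuousOn
  -- the operator `A` on the smaller space is a derivative of `h` with increment in `Z`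
  have hAe : ∀ v ∈ U ×ˢ univ, ∀ z, A v (e z) =
      multiDeriv ((ContinuousLinearMap.id ℝ X).prodMap e) h {(0, z)} v := by
    intro v hv z
    rw [hd.multiDeriv_coe hV (L := [(0, z)]) (Multiset.coe_singleton _).symm (by simp; omega) hv]
    exact (by simpa using (hA v hv (e z)).lineDeriv.symm :
      A v (e z) = lineDeriv ℝ h v (((ContinuousLinearMap.id ℝ X).prodMap e) (0, z)))
  induction s using Finset.induction_on_max with
  | empty => exact absurd hne Finset.not_nonempty_empty
  | insert a s ha ih =>
    have hnot : a ∉ s := fun h => lt_irrefl a (ha a h)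
    rw [Finset.card_insert_of_notMem hnot] at hs
    rcases s.eq_empty_or_nonempty with rfl | hsne
    · have hPP : (partialPartitions (insert a (∅ : Finset κ))).erase {insert a ∅} = {∅} := by
        ext 𝒜
        rw [Finset.mem_erase, mem_partialPartitions, Finset.mem_singleton]
        constructor
        · rintro ⟨h2, h3, h4, -⟩
          by_contra h5
          refine h2 (Finset.eq_singleton_iff_nonempty_unique_mem.2
            ⟨Finset.nonempty_iff_ne_empty.2 h5, fun p hp => ?_⟩)
          rcases Finset.subset_singleton_iff.1 (h3 p hp) with rfl | h6
          · exact absurd hp h4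
          · exact h6
        · rintro rfl
          exact ⟨(Finset.singleton_ne_empty _).symm, by simp⟩
      rw [sort_insert_of_forall_lt ha, setDeriv_insert x φ ha]
      simp only [Finset.sort_empty, List.nil_append, List.map_cons, List.map_nil]
      refine ⟨(hφ.dirDerivExistsOn_of_length_le (L := [x a]) (by simpa using hj)).1,
        fun u hu => ?_⟩
      have h2 : setDeriv x φ ∅ = φ := by simp [setDeriv, iterDirDeriv]
      have h3 : blockDeriv e h φ φZ x (insert a ∅) ∅ u = lineDeriv ℝ h (u, φ u) (x a, 0) := by
        have h4 : blockMultiset x (fun p => setDeriv x φZ p u) (insert a ∅) ∅ =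
            ([(x a, 0)] : List (X × Z)) := by simp [blockMultiset]
        rw [blockDeriv, hd.multiDeriv_coe hV h4 (by simp; omega) (hmem u hu)]
        simp [iterDirDeriv]
      rw [hPP, Finset.sum_singleton, h2, h3]
      exact h1 u hu (x a)
    · obtain ⟨hex, heq⟩ := ih (by omega) hsne
      have hsj : s.card ≤ j := by omega
      have hZs : ∀ u ∈ U, e (setDeriv x φZ s u) = setDeriv x φ s u := by
        intro u hu
        have h2 := ((hZ.dirDerivExistsOn_of_length_le (L := (s.sort (· ≤ ·)).map x)
          (by simpa using hsj)).1.clm_comp hU e).2 hu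
        exact h2.symm.trans (eqOn_iterDirDeriv hU he _ hu)
      have key : ∀ u ∈ U, ∃ z, HasLineDerivAt ℝ (setDeriv x φ s) z u (x a) ∧
          z = A (u, φ u) z + ∑ 𝒜 ∈ (partialPartitions (insert a s)).erase {insert a s},
            blockDeriv e h φ φZ x (insert a s) 𝒜 u := by
        intro u hu
        set r := ∑ 𝒜 ∈ (partialPartitions (insert a s)).erase {insert a s},
            blockDeriv e h φ φZ x (insert a s) 𝒜 u with hr
        obtain ⟨z, hz⟩ : ∃ z, z = A (u, φ u) z + r :=
          ⟨_, (eq_clm_apply_add_iff (isUnit_one_sub_of_norm_le hα (hAα _ (hmem u hu)))).2 rfl⟩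
        refine ⟨z, ?_, hz⟩
        -- the derivative of `A(u') w` for fixed `w = ∂_s φ(u)`, which lies in `Z`
        have hB : HasLineDerivAt ℝ (fun u' => A (u', φ u') (setDeriv x φ s u))
            (blockDeriv e h φ φZ x (insert a s) {s} u +
              blockDeriv e h φ φZ x (insert a s) {{a}, s} u) u (x a) := by
          have h2 := hasLineDerivAt_multiDeriv_graph hU hd he hu
            (hZ.lineDifferentiableAt hj hu (x a)) (Q := ∅) (W := fun p => setDeriv x φZ p)
            (M := {(0, setDeriv x φZ s u)}) (by simp) (by simp; omega)
          have h3 : blockMultiset x (fun p => setDeriv x φZ p u) s {s} =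
              {(0, setDeriv x φZ s u)} := by simp [blockMultiset]
          have h4 : setDeriv x φZ {a} = fun u => lineDeriv ℝ φZ u (x a) := by
            rw [← insert_empty_eq, setDeriv_insert x φZ (by simp)]
            simp [setDeriv, iterDirDeriv]
          simp only [Finset.empty_val, Multiset.map_zero, add_zero, Finset.sum_empty] at h2
          unfold blockDeriv
          rw [blockMultiset_insert _ _ hnot (singleton_mem_partialPartitions hsne),
            blockMultiset_insert_singleton _ _ hnot (singleton_mem_partialPartitions hsne), h3, h4]
          refine HasDerivAt.congr_of_eventuallyEq h2 ?_
          have h5 : Tendsto (fun t : ℝ => u + t • x a) (𝓝 0) (𝓝 u) := by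
            have : Tendsto (fun t : ℝ => u + t • x a) (𝓝 0) (𝓝 (u + (0 : ℝ) • x a)) :=
              Continuous.tendsto (by fun_prop) 0
            simpa using this
          filter_upwards [h5.eventually (hU.mem_nhds hu)] with t ht
          rw [← hZs u hu, hAe _ (hmem _ ht)]
          rfl
        have hR : HasLineDerivAt ℝ
            (fun u' => ∑ 𝒜 ∈ (partialPartitions s).erase {s}, blockDeriv e h φ φZ x s 𝒜 u')
            (∑ 𝒜 ∈ (partialPartitions s).erase {s}, (blockDeriv e h φ φZ x (insert a s) 𝒜 u +
              blockDeriv e h φ φZ x (insert a s) (insert {a} 𝒜) u +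
              ∑ p ∈ 𝒜, blockDeriv e h φ φZ x (insert a s) (insert (insert a p) (𝒜.erase p)) u))
            u (x a) := by
          refine HasDerivAt.fun_sum fun 𝒜 h𝒜 => ?_
          exact hasLineDerivAt_blockDeriv hU hd hZ hj he x ha (by omega)
            (Finset.mem_of_mem_erase h𝒜)
            (fun p hp => (card_lt_of_mem_partialPartitions_erase h𝒜 hp).trans_le hsj) hu
        have hr' := sum_partialPartitions_insert_erase hnot hsne
          (fun 𝒜 => blockDeriv e h φ φZ x (insert a s) 𝒜 u)
        rw [← hr] at hr'
        rw [hasLineDerivAt_iff_tendsto_slope_zero]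
        refine tendsto_inv_smul_of_contraction hα (e := fun t =>
          t • A (u + t • x a, φ (u + t • x a)) z +
            (A (u + t • x a, φ (u + t • x a)) (setDeriv x φ s u) -
              A (u, φ u) (setDeriv x φ s u)) +
            (∑ 𝒜 ∈ (partialPartitions s).erase {s}, blockDeriv e h φ φZ x s 𝒜 (u + t • x a) -
              ∑ 𝒜 ∈ (partialPartitions s).erase {s}, blockDeriv e h φ φZ x s 𝒜 u)) ?_ ?_
        · filter_upwards [(tendsto_add_smul_nhdsNE u (x a)).eventually (hU.mem_nhds hu)] with t ht
          refine le_of_eq_of_le (congrArg norm ?_)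
            ((A (u + t • x a, φ (u + t • x a))).le_of_opNorm_le (hAα _ (hmem _ ht)) _)
          rw [map_sub, map_sub, map_smul]
          nth_rewrite 1 [heq _ ht, heq u hu]
          abel
        · have h2 : Tendsto (fun t : ℝ => A (u + t • x a, φ (u + t • x a)) z) (𝓝[≠] 0)
              (𝓝 (A (u, φ u) z)) := by
            have h3 : ContinuousOn (fun u' => A (u', φ u') z) U :=
              (hAc z).comp (continuousOn_id.prodMk hφc) hmem
            exact (h3.continuousAt (hU.mem_nhds hu)).tendsto.comp (tendsto_add_smul_nhdsNE u (x a))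
          have h3 := (h2.add hB.tendsto_slope_zero).add hR.tendsto_slope_zero
          rw [add_assoc, ← hr', ← hz] at h3
          refine h3.congr' ?_
          filter_upwards [self_mem_nhdsWithin] with t ht
          rw [smul_add, smul_add, inv_smul_smul₀ ht]
      rw [sort_insert_of_forall_lt ha, List.map_append, dirDerivExistsOn_append,
        setDeriv_insert x φ ha]
      refine ⟨⟨hex, fun u hu => ?_, trivial⟩, fun u hu => ?_⟩
      · obtain ⟨z, hz, -⟩ := key u hu
        exact hz.lineDifferentiableAt
      · obtain ⟨z, hz, hz'⟩ := key u hu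
        simp only [hz.lineDeriv]
        exact hz'

theorem contGateaux_succ_fixedPoint [CompleteSpace Y] (hU : IsOpen U) (hα : α < 1)
    (hA : ∀ v ∈ U ×ˢ univ, ∀ w, HasLineDerivAt ℝ h (A v w) v (0, w))
    (hAα : ∀ v ∈ U ×ˢ univ, ‖A v‖ ≤ α)
    (hAc : ∀ w, ContinuousOn (fun v => A v w) (U ×ˢ univ))
    (hd : ContGateaux n ((ContinuousLinearMap.id ℝ X).prodMap e) (U ×ˢ univ) h)
    (hZ : ContGateaux j (ContinuousLinearMap.id ℝ X) U φZ) (hj : 1 ≤ j) (hjn : j + 1 ≤ n)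
    (he : ∀ u ∈ U, e (φZ u) = φ u)
    (h1 : ∀ u ∈ U, ∀ x,
      lineDeriv ℝ φ u x = A (u, φ u) (lineDeriv ℝ φ u x) + lineDeriv ℝ h (u, φ u) (x, 0)) :
    ContGateaux (j + 1) (ContinuousLinearMap.id ℝ X) U φ := by
  have hφc : ContinuousOn φ U := ((hZ.clm_comp hU e).congr hU he).continuousOn
  have hmem : ∀ u ∈ U, (u, φ u) ∈ U ×ˢ (univ : Set Y) := fun u hu => ⟨hu, trivial⟩
  intro L hL
  rcases eq_or_ne L [] with rfl | hL0
  · exact ⟨trivial, hφc⟩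
  have hcard : (Finset.univ : Finset (Fin L.length)).card = L.length := by simp
  have hne : (Finset.univ : Finset (Fin L.length)).Nonempty :=
    ⟨⟨0, List.length_pos_iff.2 hL0⟩, Finset.mem_univ _⟩
  obtain ⟨h2, h3⟩ := setDeriv_fixedPoint hU hα hA hAα hAc hd hZ hj hjn he h1 L.get Finset.univ
    (by rwa [hcard]) hne
  have hsort : ((Finset.univ : Finset (Fin L.length)).sort (· ≤ ·)).map L.get = L := by
    rw [Fin.sort_univ, ← List.ofFn_eq_map, List.ofFn_get]
  have hmap : L.map (ContinuousLinearMap.id ℝ X) = L := by simp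
  rw [hmap]
  have h4 := continuousOn_of_eq_clm_apply_add hα (fun u hu => hAα _ (hmem u hu))
    (fun y => (hAc y).comp (continuousOn_id.prodMk hφc) hmem)
    (continuousOn_finsetSum _ fun 𝒜 h𝒜 => continuousOn_blockDeriv hU hd hZ hφc L.get
      (by rw [hcard]; omega) (Finset.mem_of_mem_erase h𝒜) fun p hp => by
        have := card_lt_of_mem_partialPartitions_erase h𝒜 hp
        omega) h3
  rw [setDeriv, hsort] at h4
  rw [hsort] at h2
  exact ⟨h2, h4⟩

end OrderGain

/-! ### Chains of spaces -/

section BlockIncrements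

variable {X Y Z : Type*} [NormedAddCommGroup X] [NormedSpace ℝ X]
  [NormedAddCommGroup Y] [NormedSpace ℝ Y] [NormedAddCommGroup Z] [NormedSpace ℝ Z]
  {n j : ℕ} {U : Set X} {h : X × Y → Y} {φ : X → Y} {φZ : X → Z} {e : Z →L[ℝ] Y}

theorem setDeriv_univ (x : Fin j → X) (f : X → Y) :
    setDeriv x f Finset.univ = iterDirDeriv f (List.ofFn x) := by
  rw [setDeriv, Fin.sort_univ, ← List.ofFn_eq_map]

theorem ContGateaux.clm_setDeriv {m : ℕ} {κ : Type*} [LinearOrder κ] (hU : IsOpen U)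
    (hZ : ContGateaux m (ContinuousLinearMap.id ℝ X) U φZ) (he : ∀ u ∈ U, e (φZ u) = φ u)
    (x : κ → X) {s : Finset κ} (hs : s.card ≤ m) {u : X} (hu : u ∈ U) :
    e (setDeriv x φZ s u) = setDeriv x φ s u :=
  ((hZ.dirDerivExistsOn_of_length_le (L := (s.sort (· ≤ ·)).map x)
    (by simpa using hs)).1.clm_comp hU e).2 hu |>.symm.trans (eqOn_iterDirDeriv hU he _ hu)

theorem parts_mem_partialPartitions_erase {s : Finset (Fin j)} {P : Finpartition s}
    (hP : 2 + s.card ≤ j + P.parts.card) :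
    P.parts ∈ (partialPartitions (Finset.univ : Finset (Fin j))).erase {Finset.univ} := by
  refine Finset.mem_erase.2 ⟨fun h => ?_, mem_partialPartitions.2 ⟨fun p _ => Finset.subset_univ p,
    P.bot_notMem, fun p hp q hq hpq => P.disjoint hp hq hpq⟩⟩
  have h5 : s = Finset.univ := by rw [← P.sup_parts, h, Finset.sup_singleton]; rfl
  rw [h, Finset.card_singleton, h5, Finset.card_univ, Fintype.card_fin] at hP
  omega

/-- The increments of a block derivative come from `X × Z`. -/
theorem exists_blockIncrements_eq_map {m : ℕ} (hU : IsOpen U)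
    (hZ : ContGateaux m (ContinuousLinearMap.id ℝ X) U φZ) (he : ∀ u ∈ U, e (φZ u) = φ u)
    (hjm : j ≤ m + 1) (x : Fin j → X) {s : Finset (Fin j)} {P : Finpartition s}
    (hP : 2 + s.card ≤ j + P.parts.card) {u : X} (hu : u ∈ U) :
    ∃ L : List (X × Z), L.length ≤ j ∧
      blockIncrements φ u x s P = L.map ((ContinuousLinearMap.id ℝ X).prodMap e) ∧
      blockMultiset x (fun p => setDeriv x φZ p u) Finset.univ P.parts = L := by
  refine ⟨(P.parts.toList.map fun p => ((0 : X), setDeriv x φZ p u)) ++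
    ((sᶜ.sort (· ≤ ·)).map fun a => (x a, (0 : Z))), ?_, ?_, ?_⟩
  · have h1 := P.card_parts_le_card
    have h2 : s.card ≤ j := (Finset.card_le_univ s).trans_eq (Fintype.card_fin j)
    simp only [List.length_append, List.length_map, Finset.length_toList, Finset.length_sort,
      Finset.card_compl, Fintype.card_fin]
    omega
  · rw [blockIncrements, List.map_append, List.map_map, List.map_map]
    congr 1
    · refine List.map_congr_left fun p hp => ?_
      have hlt := card_lt_of_mem_partialPartitions_erase (parts_mem_partialPartitions_erase hP)
        (Finset.mem_toList.1 hp)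
      rw [Finset.card_univ, Fintype.card_fin] at hlt
      have h1 := hZ.clm_setDeriv hU he x (s := p) (by omega) hu
      exact Prod.ext rfl h1.symm
    · refine List.map_congr_left fun a _ => ?_
      exact Prod.ext rfl (map_zero e).symm
  · have h1 : P.parts.sup id = s := P.sup_parts
    rw [blockMultiset, h1, ← Finset.compl_eq_univ_sdiff, ← Multiset.coe_add, ← Multiset.map_coe,
      ← Multiset.map_coe, Finset.sort_eq, Finset.coe_toList, add_comm]

end BlockIncrements

namespace ChainContraction

variable {X : Type*} [NormedAddCommGroup X] [NormedSpace ℝ X]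
  {Y : ℕ → Type*} [∀ k, NormedAddCommGroup (Y k)] [∀ k, NormedSpace ℝ (Y k)]
  {n : ℕ} {α : ℝ} {U : Set X} {emb : ∀ k j, Y k →L[ℝ] Y j} {h : ∀ k, X × Y k → Y k}

theorem contGateaux_inr (hyp : ChainContraction n α U emb h) {k : ℕ} (hk : 1 ≤ k) (hkn : k ≤ n) :
    ContGateaux 1 (ContinuousLinearMap.inr ℝ X (Y k)) (U ×ˢ univ) (h k) := by
  have hlist : ∀ w : Y k, (List.ofFn fun a =>
      (Fin.snoc (fun b : Fin 0 => ((Fin.elim0 b : X), 0)) (0, w) : Fin (0 + 1) → X × Y k)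
        ((1 : Equiv.Perm (Fin (0 + 1))) a)) = [(0, w)] := by
    intro w
    simp [List.ofFn_succ, Fin.snoc]
  intro L hL
  rcases L with _ | ⟨w, _ | ⟨y, l⟩⟩
  · exact ⟨trivial, hyp.continuousOn k hk hkn⟩
  · have h1 := hyp.mixed_exists k hk hkn 0 hyp.one_le 1 Fin.elim0 w
    have h2 := (hyp.mixed_continuous k hk hkn 0 hyp.one_le 1).comp
      (f := fun v : X × Y k => (v, (Fin.elim0, w))) (s := U ×ˢ univ) (by fun_prop)
      (fun v hv => ⟨hv, trivial⟩)
    simp only [Function.comp_def] at h2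
    rw [hlist] at h1
    simp only [hlist] at h2
    exact ⟨h1, h2⟩
  · simp at hL

theorem contGateaux_inl (hyp : ChainContraction n α U emb h) {k : ℕ} (hk : 1 ≤ k) (hkn : k ≤ n) :
    ContGateaux n (ContinuousLinearMap.inl ℝ X (Y k)) (U ×ˢ univ) (h k) :=
  (hyp.gateaux_param k hk hkn).contGateaux (hyp.isOpen.prod isOpen_univ)

theorem exists_fixedPoint [∀ k, CompleteSpace (Y k)] (hyp : ChainContraction n α U emb h) {k : ℕ}
    (hk : 1 ≤ k) (hkn : k ≤ n) {u : X} (hu : u ∈ U) : ∃ y, h k (u, y) = y := by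
  have hc : ContractingWith ⟨α, hyp.alpha_nonneg⟩ (fun y => h k (u, y)) := by
    refine ⟨hyp.alpha_lt_one, LipschitzWith.of_dist_le_mul fun y y' => ?_⟩
    rw [dist_eq_norm, dist_eq_norm]
    exact hyp.contraction k hk hkn u hu y y'
  exact ⟨_, hc.fixedPoint_isFixedPt⟩

/-- The fixed points of `h k` are those of `h 1`. -/
theorem emb_fixedPoint (hyp : ChainContraction n α U emb h) {k : ℕ}
    (hk : 1 ≤ k) (hkn : k ≤ n) {u : X} (hu : u ∈ U) {y : Y k} (hy : h k (u, y) = y) {y₁ : Y 1}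
    (hy₁ : h 1 (u, y₁) = y₁) : emb k 1 y = y₁ := by
  have h1 := hyp.induced k hk hkn u hu y
  have h2 := hyp.contraction 1 le_rfl hyp.one_le u hu (emb k 1 y) y₁
  rw [h1, hy, hy₁] at h2
  have h3 := hyp.alpha_lt_one
  have h4 : ‖emb k 1 y - y₁‖ = 0 := by
    nlinarith [norm_nonneg (emb k 1 y - y₁)]
  exact sub_eq_zero.1 (norm_eq_zero.1 h4)

/-- The partial differentials `∂_{Y_k} h k`, as contractions. -/
theorem exists_clm_deriv [∀ k, CompleteSpace (Y k)] (hyp : ChainContraction n α U emb h) {k : ℕ}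
    (hk : 1 ≤ k) (hkn : k ≤ n) :
    ∃ A : X × Y k → Y k →L[ℝ] Y k,
      (∀ v ∈ U ×ˢ univ, ∀ w, HasLineDerivAt ℝ (h k) (A v w) v (0, w)) ∧
      (∀ v ∈ U ×ˢ univ, ‖A v‖ ≤ α) ∧ ∀ w, ContinuousOn (fun v => A v w) (U ×ˢ univ) :=
  exists_clm_deriv_of_contraction hyp.isOpen hyp.alpha_nonneg (hyp.contraction k hk hkn)
    (hyp.contGateaux_inr hk hkn)

variable [CompleteSpace X] [∀ k, CompleteSpace (Y k)]

/-- Each step down the chain of spaces gains one order of differentiability. -/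
theorem contGateaux_fixedPoint (hyp : ChainContraction n α U emb h) {ψ : ∀ k, X → Y k}
    (hψ : ∀ k, 1 ≤ k → k ≤ n → ∀ u ∈ U, h k (u, ψ k u) = ψ k u)
    (hemb : ∀ k, 1 ≤ k → k + 1 ≤ n → ∀ u ∈ U, emb (k + 1) k (ψ (k + 1) u) = ψ k u)
    {j : ℕ} (hj : 1 ≤ j) {k : ℕ} (hk : 1 ≤ k) (hjk : k + j = n + 1) :
    ContGateaux j (ContinuousLinearMap.id ℝ X) U (ψ k) := by
  induction j, hj using Nat.le_induction generalizing k with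
  | base =>
    obtain ⟨A, hA, hAα, hAc⟩ := hyp.exists_clm_deriv hk (by omega)
    exact (contGateaux_one_fixedPoint hyp.isOpen hyp.alpha_lt_one
      (hyp.contraction k hk (by omega)) hA hAα hAc
      ((hyp.contGateaux_inl hk (by omega)).mono hyp.one_le) (hψ k hk (by omega))).1
  | succ j hj ih =>
    obtain ⟨A, hA, hAα, hAc⟩ := hyp.exists_clm_deriv hk (by omega)
    have h1 := (contGateaux_one_fixedPoint hyp.isOpen hyp.alpha_lt_one
      (hyp.contraction k hk (by omega)) hA hAα hAc
      ((hyp.contGateaux_inl hk (by omega)).mono hyp.one_le) (hψ k hk (by omega))).2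
    exact contGateaux_succ_fixedPoint hyp.isOpen hyp.alpha_lt_one hA hAα hAc
      ((hyp.gateaux_subspace k hk (by omega)).contGateaux (hyp.isOpen.prod isOpen_univ))
      (ih (k := k + 1) (by omega) (by omega)) hj (by omega) (hemb k hk (by omega)) h1

end ChainContraction

theorem theorem2p12
    {X : Type*} [NormedAddCommGroup X] [NormedSpace ℝ X] [CompleteSpace X]
    {Y : ℕ → Type*} [∀ k, NormedAddCommGroup (Y k)] [∀ k, NormedSpace ℝ (Y k)]
    [∀ k, CompleteSpace (Y k)]
    (n : ℕ) (α : ℝ) (U : Set X) (emb : ∀ k j, Y k →L[ℝ] Y j) (h : ∀ k, X × Y k → Y k)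
    (hyp : ChainContraction n α U emb h)
    (φ : X → Y 1) (hφ : ∀ u ∈ U, h 1 (u, φ u) = φ u) :
    -- `φ ∈ 𝒢ʲ(U, Y_{n-j+1})`
    (∀ j, 1 ≤ j → j ≤ n → ∃ ψ : X → Y (n - j + 1),
      (∀ u ∈ U, emb (n - j + 1) 1 (ψ u) = φ u) ∧
      GSpace j (ContinuousLinearMap.id ℝ X) U ψ) ∧
    -- all derivatives in the formula exist
    (∀ j, 1 ≤ j → j ≤ n → ∀ x : Fin j → X,
      DirDerivExistsOn U φ (List.ofFn x) ∧
      DirDerivExistsOn (U ×ˢ univ) (h 1) (List.ofFn fun a => (x a, (0 : Y 1))) ∧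
      ∀ u ∈ U, ∀ s : Finset (Fin j), s.Nonempty → ∀ P : Finpartition s,
        2 + s.card ≤ j + P.parts.card →
        DirDerivExistsOn (U ×ˢ univ) (h 1) (blockIncrements φ u x s P)) ∧
    -- the formula, with `A = ∂_{Y₁} h₁(u, φ(u))`
    (∀ u ∈ U, ∃ A : Y 1 →L[ℝ] Y 1,
      IsGateauxDiffAt (ContinuousLinearMap.inr ℝ X (Y 1)) (h 1) (u, φ u) A ∧
      IsUnit (1 - A) ∧
      ∀ j, 1 ≤ j → j ≤ n → ∀ x : Fin j → X,
        iterDirDeriv φ (List.ofFn x) u =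
          Ring.inverse (1 - A)
            (iterDirDeriv (h 1) (List.ofFn fun a => (x a, (0 : Y 1))) (u, φ u)) +
          ∑ s : Finset (Fin j) with s.Nonempty,
            ∑ i ∈ Finset.Icc (max 1 (2 + s.card - j)) s.card,
              ∑ P : Finpartition s with P.parts.card = i,
                Ring.inverse (1 - A)
                  (iterDirDeriv (h 1) (blockIncrements φ u x s P) (u, φ u))) := by
  have hU := hyp.isOpen
  have hn := hyp.one_le
  have hV : IsOpen (U ×ˢ (univ : Set (Y 1))) := hU.prod isOpen_univ
  have hmem : ∀ u ∈ U, (u, φ u) ∈ U ×ˢ (univ : Set (Y 1)) := fun u hu => ⟨hu, trivial⟩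
  have hex : ∀ k, ∃ ψ : X → Y k, 1 ≤ k → k ≤ n → ∀ u ∈ U, h k (u, ψ u) = ψ u := by
    intro k
    by_cases hk : 1 ≤ k ∧ k ≤ n
    · choose! ψ hψ using fun u (hu : u ∈ U) => hyp.exists_fixedPoint hk.1 hk.2 hu
      exact ⟨ψ, fun _ _ => hψ⟩
    · exact ⟨0, fun h1 h2 => absurd ⟨h1, h2⟩ hk⟩
  choose ψ hψ using hex
  have hψφ : ∀ k, 1 ≤ k → k ≤ n → ∀ u ∈ U, emb k 1 (ψ k u) = φ u := fun k hk hkn u hu =>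
    hyp.emb_fixedPoint hk hkn hu (hψ k hk hkn u hu) (hφ u hu)
  have hemb : ∀ k, 1 ≤ k → k + 1 ≤ n → ∀ u ∈ U, emb (k + 1) k (ψ (k + 1) u) = ψ k u := by
    intro k hk hkn u hu
    refine hyp.emb_injective k 1 le_rfl hk (by omega) ?_
    rw [hyp.emb_comp (k + 1) k 1 le_rfl hk (by omega) hkn, hψφ _ (by omega) hkn u hu,
      hψφ k hk (by omega) u hu]
  have hG : ∀ {j k : ℕ}, 1 ≤ j → 1 ≤ k → k + j = n + 1 →
      ContGateaux j (ContinuousLinearMap.id ℝ X) U (ψ k) :=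
    fun hj hk hjk => hyp.contGateaux_fixedPoint hψ hemb hj hk hjk
  have hφG : ContGateaux n (ContinuousLinearMap.id ℝ X) U φ :=
    (hG hn le_rfl (by omega)).congr hU fun u hu => by
      rw [← hψφ 1 le_rfl hn u hu, hyp.emb_self 1 le_rfl hn]
  have hinl := hyp.contGateaux_inl le_rfl hn
  have hinl_list : ∀ {j : ℕ} (x : Fin j → X), (List.ofFn fun a => (x a, (0 : Y 1))) =
      (List.ofFn x).map (ContinuousLinearMap.inl ℝ X (Y 1)) := by
    intro j x
    rw [List.map_ofFn]
    rfl
  -- the derivatives of `h 1` in the formula are block derivatives, with increments in `X × Y 2`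
  have hsub : 2 ≤ n → ContGateaux n ((ContinuousLinearMap.id ℝ X).prodMap (emb 2 1))
      (U ×ˢ univ) (h 1) := fun h2 => (hyp.gateaux_subspace 1 le_rfl h2).contGateaux hV
  have hZ : 2 ≤ n → ContGateaux (n - 1) (ContinuousLinearMap.id ℝ X) U (ψ 2) := fun h2 =>
    hG (by omega) (by omega) (by omega)
  have hblock : 2 ≤ n → ∀ {j : ℕ}, j ≤ n → ∀ (x : Fin j → X), ∀ u ∈ U, ∀ (s : Finset (Fin j))
      (P : Finpartition s), 2 + s.card ≤ j + P.parts.card →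
      DirDerivExistsOn (U ×ˢ univ) (h 1) (blockIncrements φ u x s P) ∧
      blockDeriv (emb 2 1) (h 1) φ (ψ 2) x Finset.univ P.parts u =
        iterDirDeriv (h 1) (blockIncrements φ u x s P) (u, φ u) := by
    intro h2 j hjn x u hu s P hP
    obtain ⟨L, hL, h3, h4⟩ := exists_blockIncrements_eq_map hU (hZ h2) (hψφ 2 (by omega) h2)
      (by omega) x hP hu
    rw [h3]
    exact ⟨((hsub h2) L (hL.trans hjn)).1,
      (hsub h2).multiDeriv_coe hV h4 (hL.trans hjn) (hmem u hu)⟩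
  obtain ⟨A, hA, hAα, hAc⟩ := hyp.exists_clm_deriv le_rfl hn
  have hone := (contGateaux_one_fixedPoint hU hyp.alpha_lt_one
    (hyp.contraction 1 le_rfl hn) hA hAα hAc (hinl.mono hn) hφ).2
  refine ⟨fun j hj hjn => ⟨ψ (n - j + 1), hψφ _ (by omega) (by omega),
    (hG hj (by omega) (by omega)).gspace hU⟩, fun j hj hjn x => ⟨?_, ?_, ?_⟩,
    fun u hu => ⟨A (u, φ u), ?_, ?_, ?_⟩⟩
  · exact (hφG.dirDerivExistsOn_of_length_le (by simpa using hjn)).1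
  · rw [hinl_list]
    exact (hinl _ (by simpa using hjn)).1
  · intro u hu s hs P hP
    have h1 := P.card_parts_le_card
    have h2 : s.card ≤ j := (Finset.card_le_univ s).trans_eq (Fintype.card_fin j)
    exact (hblock (by omega) hjn x u hu s P hP).1
  · exact fun w => (hA _ (hmem u hu) w).tendsto_slope_zero
  · exact isUnit_one_sub_of_norm_le hyp.alpha_lt_one (hAα _ (hmem u hu))
  · intro j hj hjn x
    have hunit := isUnit_one_sub_of_norm_le hyp.alpha_lt_one (hAα _ (hmem u hu))
    simp only [← map_sum]
    rw [← map_add, ← eq_clm_apply_add_iff hunit]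
    rcases Nat.lt_or_ge n 2 with hn2 | hn2
    · obtain rfl : j = 1 := by omega
      rw [Finset.sum_eq_zero fun s _ => by
        rw [Finset.Icc_eq_empty (by omega), Finset.sum_empty], add_zero]
      have h1 := hone u hu (x 0)
      simpa [iterDirDeriv, List.ofFn_succ] using h1
    · have : Nonempty (Fin j) := ⟨⟨0, hj⟩⟩
      have h1 := (setDeriv_fixedPoint hU hyp.alpha_lt_one hA hAα hAc (hsub hn2) (hZ hn2)
        (by omega) (by omega) (hψφ 2 (by omega) hn2) hone x Finset.univ
        (by rw [Finset.card_univ, Fintype.card_fin]; omega) Finset.univ_nonempty).2 u hu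
      rw [sum_partialPartitions_univ hj] at h1
      rw [setDeriv_univ] at h1
      have h2 : blockDeriv (emb 2 1) (h 1) φ (ψ 2) x Finset.univ ∅ u =
          iterDirDeriv (h 1) (List.ofFn fun a => (x a, (0 : Y 1))) (u, φ u) := by
        have h3 : blockMultiset x (fun p => setDeriv x (ψ 2) p u) Finset.univ ∅ =
            ((List.ofFn fun a => (x a, (0 : Y 2)) : List (X × Y 2)) : Multiset (X × Y 2)) := by
          rw [List.ofFn_eq_map, ← Multiset.map_coe]
          simp [blockMultiset, List.ofFn_eq_map]
        have h4 : (List.ofFn fun a => (x a, (0 : Y 1))) = (List.ofFn fun a => (x a, (0 : Y 2))).map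
            ((ContinuousLinearMap.id ℝ X).prodMap (emb 2 1)) := by
          rw [List.map_ofFn]
          refine congrArg List.ofFn (funext fun a => Prod.ext rfl (map_zero (emb 2 1)).symm)
        rw [h4]
        exact (hsub hn2).multiDeriv_coe hV h3 (by simpa using hjn) (hmem u hu)
      rw [h2] at h1
      refine h1.trans (congrArg₂ _ rfl (congrArg₂ _ rfl ?_))
      refine Finset.sum_congr rfl fun s _ => Finset.sum_congr rfl fun i hi =>
        Finset.sum_congr rfl fun P hP => (hblock hn2 hjn x u hu s P ?_).2
      have h3 := (Finset.mem_Icc.1 hi).1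
      have h4 := (Finset.mem_filter.1 hP).2
      omega
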